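/- Let $m_1,m_2$ be natural numbers and let $v(x,t)$ be an $m_1\times m_2$ complex matrix function on the closed quarter-plane $\Omega_\infty=\{x\ge 0,\ t\ge 0\}$ that is continuously differentiable there and has a second derivative $v_{xx}$ there (derivatives are one-sided on the boundary). Suppose that $v$ satisfies the defocusing matrix nonlinear Schrödinger equation $$2v_t=\mathrm{i}\,(v_{xx}-2vv^*v)\quad\text{on }\Omega_\infty ,$$ and that $\sup_{x>0,\ 0\le s\le t}\|v(x,s)\|<\infty$ for every $t\ge 0$, where $\|\cdot\|$ is the operator norm. Put $h_2(t)=v(0,t)$, $h_3(t)=v_x(0,t)$, and suppose that $h_2,h_3$ are continuous with $$\sup_{t\ge 0}\|h_2(t)\|<\widehat M,\qquad \sup_{t\ge 0}\|h_3(t)\|<\infty$$ for some $\widehat M>0$. Let $$j=\begin{bmatrix}I_{m_1}&0\\0&-I_{m_2}\end{bmatrix},\qquad V=\begin{bmatrix}0&v\\v^*&0\end{bmatrix}.$$ A Weyl function of the initial Dirac system $y'(x)=\mathrm{i}\,(zj+jV(x,0))\,y(x)$, $x\ge 0$, is an $m_2\times m_1$ matrix function $\varphi(0,z)$, holomorphic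 in $z$ for $\operatorname{Im}z>0$, such that $$\int_0^\infty \begin{bmatrix}I_{m_1}&\varphi(0,z)^*\end{bmatrix}u(x,z)^*u(x,z)\begin{bmatrix}I_{m_1}\\ \varphi(0,z)\end{bmatrix}dx<\infty\qquad(\operatorname{Im}z>0),$$ where $u$ is the fundamental solution of the system with $u(0,z)=I_{m_1+m_2}$. Let $R(t,z)$ be the solution of $$R_t(t,z)=-\mathrm{i}\Big(z^2j+z\,jV(0,t)-\tfrac12\big(\mathrm{i}V_x(0,t)-jV(0,t)^2\big)\Big)R(t,z),\quad t\ge0,\qquad R(0,z)=I_{m_1+m_2},$$ and let $R_{ik}(t,z)$ be its $m_i\times m_k$ blocks; $R$ depends only on $h_2$ and $h_3$. Then the following hold. 1. The initial system has a Weyl function $\varphi(0,z)$. 2. For every $z$ with $\operatorname{Im}z\ge \tfrac12$ and $\operatorname{Re}z\le-\widehat M$, the block $R_{22}(t,z)$ is invertible for all $t\ge 0$, and for any Weyl function $\varphi(0,\cdot)$ of the initial system $$\varphi(0,z)=-\lim_{t\to\infty}R_{22}(t,z)^{-1}R_{21}(t,z).$$ 3. The solution is determined by the boundary data alone: if $w$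 is another continuously differentiable solution of the same equation on $\Omega_\infty$ such that $w_{xx}$ exists, $\sup_{x>0,\ 0\le s\le t}\|w(x,s)\|<\infty$ for every $t\ge0$, and $w(0,t)=h_2(t)$, $w_x(0,t)=h_3(t)$ for all $t\ge0$, then $w=v$ on $\Omega_\infty$. -/

import Mathlib

open Set Filter Topology

namespace DNLS

section Norm

open scoped Matrix.Norms.L2Operator

/-- The operator (spectral) norm of a complex matrix, acting between Euclidean spaces. -/
noncomputable def opNorm {m n : ℕ} (A : Matrix (Fin m) (Fin n) ℂ) : ℝ := ‖A‖

end Norm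

/-- `m × m` matrices, `m = m₁ + m₂`, indexed so that the blocks are visible. -/
abbrev BlockMat (m₁ m₂ : ℕ) : Type := Matrix (Fin m₁ ⊕ Fin m₂) (Fin m₁ ⊕ Fin m₂) ℂ

/-- `j = diag(I_{m₁}, -I_{m₂})`. -/
def jMat (m₁ m₂ : ℕ) : BlockMat m₁ m₂ := Matrix.fromBlocks 1 0 0 (-1)

/-- `V = [[0, v], [v*, 0]]`. -/
def potential {m₁ m₂ : ℕ} (v : Matrix (Fin m₁) (Fin m₂) ℂ) : BlockMat m₁ m₂ :=
  Matrix.fromBlocks 0 v v.conjTranspose 0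

/-- `G = i (z j + j V)`. -/
noncomputable def auxG {m₁ m₂ : ℕ} (z : ℂ) (v : Matrix (Fin m₁) (Fin m₂) ℂ) : BlockMat m₁ m₂ :=
  Complex.I • (z • jMat m₁ m₂ + jMat m₁ m₂ * potential v)

/-- `F = -i (z² j + z j V - (i V_x - j V²) / 2)`; `vx` is the value of `v_x`. -/
noncomputable def auxF {m₁ m₂ : ℕ} (z : ℂ) (v vx : Matrix (Fin m₁) (Fin m₂) ℂ) :
    BlockMat m₁ m₂ :=
  (-Complex.I) • (z ^ 2 • jMat m₁ m₂ + z • (jMat m₁ m₂ * potential v)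
    - (1 / 2 : ℂ) • (Complex.I • potential vx - jMat m₁ m₂ * (potential v * potential v)))

/-- Entrywise derivative of a matrix function on `[0, ∞)`, one-sided at `0`. -/
noncomputable def halfDeriv {m₁ m₂ : ℕ} (f : ℝ → Matrix (Fin m₁) (Fin m₂) ℂ) (s : ℝ) :
    Matrix (Fin m₁) (Fin m₂) ℂ :=
  Matrix.of fun i k => derivWithin (fun r => f r i k) (Ici 0) s

/-- `v_x(x, t)`. -/
noncomputable def partialX {m₁ m₂ : ℕ} (v : ℝ → ℝ → Matrix (Fin m₁) (Fin m₂) ℂ) (x t : ℝ) :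
    Matrix (Fin m₁) (Fin m₂) ℂ :=
  halfDeriv (fun y => v y t) x

/-- `v_t(x, t)`. -/
noncomputable def partialT {m₁ m₂ : ℕ} (v : ℝ → ℝ → Matrix (Fin m₁) (Fin m₂) ℂ) (x t : ℝ) :
    Matrix (Fin m₁) (Fin m₂) ℂ :=
  halfDeriv (fun s => v x s) t

/-- `v(x, t)` is a solution of the matrix defocusing nonlinear Schrödinger equation
`2 v_t = i (v_xx - 2 v v* v)` on the closed quarter-plane `x ≥ 0`, `t ≥ 0`, in the class of
continuously differentiable functions that possess `v_xx` and are bounded on every strip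
`x > 0`, `0 ≤ s ≤ t`. -/
structure IsSolution {m₁ m₂ : ℕ} (v : ℝ → ℝ → Matrix (Fin m₁) (Fin m₂) ℂ) : Prop where
  contDiff : ∀ i k, ContDiffOn ℝ 1 (fun p : ℝ × ℝ => v p.1 p.2 i k) (Ici 0 ×ˢ Ici 0)
  exists_xx : ∀ x ≥ 0, ∀ t ≥ 0, ∀ i k,
    DifferentiableWithinAt ℝ (fun y => partialX v y t i k) (Ici 0) x
  equation : ∀ x ≥ 0, ∀ t ≥ 0,
    (2 : ℂ) • partialT v x t =
      Complex.I • (partialX (partialX v) x t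
        - (2 : ℂ) • (v x t * (v x t).conjTranspose * v x t))
  bounded : ∀ t ≥ 0, ∃ M > 0, ∀ x > 0, ∀ s ∈ Icc 0 t, opNorm (v x s) ≤ M

/-- `Y(s, z)` is, for each `z`, the fundamental solution on `[0, ∞)` of
`dY/ds = A(s, z) Y` normalized by `Y(0, z) = I_m`. -/
def IsFundamentalSolution {m₁ m₂ : ℕ} (A Y : ℝ → ℂ → BlockMat m₁ m₂) : Prop :=
  ∀ z : ℂ, Y 0 z = 1 ∧
    ∀ s ≥ 0, HasDerivWithinAt (fun r => Y r z) (A s z * Y s z) (Ici 0) s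

/-- `φ` is a Weyl function of the Dirac system `y' = i (z j + j V(x)) y`, `x ≥ 0`, with
continuous `v`: it is holomorphic in the open upper half-plane and
`∫₀^∞ [I φ(z)*] u(x,z)* u(x,z) [I; φ(z)] dx < ∞` there, `u` being the fundamental solution
normalized at `x = 0`. -/
def IsWeylFunction {m₁ m₂ : ℕ} (v : ℝ → Matrix (Fin m₁) (Fin m₂) ℂ)
    (φ : ℂ → Matrix (Fin m₂) (Fin m₁) ℂ) : Prop :=
  (∀ i k, DifferentiableOn ℂ (fun z => φ z i k) {z | 0 < z.im}) ∧
  ∃ u : ℝ → ℂ → BlockMat m₁ m₂,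
    IsFundamentalSolution (fun x z => auxG z (v x)) u ∧
    ∀ z : ℂ, 0 < z.im → ∀ i k, MeasureTheory.IntegrableOn
      (fun x : ℝ => ((u x z * Matrix.fromRows (1 : Matrix (Fin m₁) (Fin m₁) ℂ) (φ z)).conjTranspose
        * (u x z * Matrix.fromRows (1 : Matrix (Fin m₁) (Fin m₁) ℂ) (φ z))) i k) (Ioi 0)

end DNLS

/-! Everything rests on the indefinite form `y* j y = |y₁|² - |y₂|²` (`indef`). Along the `x`-system
its derivative is `-2 Im z |y|²`, the potential cancelling because it is Hermitian (`re_form_auxG`).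
So for `Im z > 0` the matrices `φ` whose solutions started at `[I; φ]` have nonnegative form at `s`
make up Weyl discs that shrink as `s` grows, with squared diameter `O(1/s)`
(`nsq_sub_le_of_indef_nonneg`). The common point of all discs is the Weyl function: lying in every
disc is the same as square integrability (`indef_nonneg_of_integrableOn`, `integrableOn_nsq`), and
locally uniform convergence of the disc centres gives holomorphy (`exists_isWeylFunction`).

On the boundary `x = 0` the `t`-system has the same structure in the quadrant `Re z ≤ -M`, `Im z ≥
1/2`: there the form decreases at rate at least `M |y|²` (`isDissipative_auxF`), so the discs of `R`
shrink to a point and `-R₂₂⁻¹ R₂₁` converges to it. It remains to see that `φ(0, z)` lies in all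
discs of `R`. By the zero-curvature equation, `W(x, t) = u(x, t) R(t)`, with `u(·, t)` the
normalized solution of the `x`-system at time `t`, solves both systems. Along a line `x = C (T - t)`
with `C` large, the form of `W g` increases, since moving left gains more than the `t`-evolution can
lose. Hence the form at `(0, T)` dominates the form at `(C T, 0)`, which is nonnegative for Weyl
data (`IsSolution.indef_nonneg`).

For uniqueness, equal boundary data give the same `R`, so the initial Weyl functions agree on a
quadrant and then on the half-plane. The Borg–Marchenko theorem (`potential_unique_of_weyl`) turns
this into equal initial values: the quotient of the two fundamental solutions is entire and bounded
in `z`, hence constant by Liouville, and a factor free of `z` must be trivial. Restarting the clock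
at time `t` gives equality everywhere (`IsSolution.eq_of_boundary`). -/

namespace DNLS

open Matrix

/-! ### Hermitian and indefinite forms on block vectors. -/

section Forms

variable {ι : Type*} [Fintype ι] {m₁ m₂ : ℕ}

/-- The squared Euclidean length of a complex vector. -/
noncomputable def nsq (y : ι → ℂ) : ℝ := ∑ i, ‖y i‖ ^ 2

lemma nsq_nonneg (y : ι → ℂ) : 0 ≤ nsq y := Finset.sum_nonneg fun _ _ => by positivity

lemma norm_apply_sq_le_nsq (y : ι → ℂ) (i : ι) : ‖y i‖ ^ 2 ≤ nsq y :=
  Finset.single_le_sum (f := fun i => ‖y i‖ ^ 2) (fun _ _ => by positivity) (Finset.mem_univ i)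

lemma nsq_eq_zero {y : ι → ℂ} (h : nsq y ≤ 0) : y = 0 := by
  ext i
  have := (norm_apply_sq_le_nsq y i).trans h
  simpa using le_antisymm this (by positivity)

lemma sqrt_nsq (y : ι → ℂ) : √(nsq y) = ‖WithLp.toLp 2 y‖ := by
  simp [EuclideanSpace.norm_eq, nsq]

lemma nsq_eq_norm_sq (y : ι → ℂ) : nsq y = ‖WithLp.toLp 2 y‖ ^ 2 := by
  rw [← sqrt_nsq, Real.sq_sqrt (nsq_nonneg y)]

lemma nsq_smul (c : ℂ) (y : ι → ℂ) : nsq (c • y) = ‖c‖ ^ 2 * nsq y := by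
  simp [nsq, mul_pow, Finset.mul_sum]

@[simp] lemma nsq_zero : nsq (0 : ι → ℂ) = 0 := by simp [nsq]

@[simp] lemma nsq_neg (y : ι → ℂ) : nsq (-y) = nsq y := by simp [nsq]

lemma star_dotProduct_self (y : ι → ℂ) : star y ⬝ᵥ y = (nsq y : ℂ) := by
  simp [dotProduct, nsq, ← Complex.normSq_eq_norm_sq, Complex.normSq_eq_conj_mul_self]

lemma norm_star_dotProduct_le (x y : ι → ℂ) : ‖star x ⬝ᵥ y‖ ≤ √(nsq x) * √(nsq y) := by
  rw [sqrt_nsq, sqrt_nsq]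
  have := norm_inner_le_norm (𝕜 := ℂ) (WithLp.toLp 2 x) (WithLp.toLp 2 y)
  rwa [EuclideanSpace.inner_toLp_toLp, dotProduct_comm] at this

lemma norm_star_dotProduct_le_half (x y : ι → ℂ) :
    2 * ‖star x ⬝ᵥ y‖ ≤ nsq x + nsq y := by
  have h := norm_star_dotProduct_le x y
  have hx := Real.sq_sqrt (nsq_nonneg x)
  have hy := Real.sq_sqrt (nsq_nonneg y)
  nlinarith [sq_nonneg (√(nsq x) - √(nsq y))]

lemma hasDerivWithinAt_star_dotProduct {x y : ℝ → ι → ℂ} {x' y' : ι → ℂ} {S : Set ℝ} {s : ℝ}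
    (hx : HasDerivWithinAt x x' S s) (hy : HasDerivWithinAt y y' S s) :
    HasDerivWithinAt (fun r => star (x r) ⬝ᵥ y r) (star x' ⬝ᵥ y s + star (x s) ⬝ᵥ y') S s := by
  rw [hasDerivWithinAt_pi] at hx hy
  simp only [dotProduct, ← Finset.sum_add_distrib]
  exact HasDerivWithinAt.fun_sum fun i _ => ((hx i).star).mul (hy i)

lemma hasDerivWithinAt_nsq {y : ℝ → ι → ℂ} {y' : ι → ℂ} {S : Set ℝ} {s : ℝ}
    (hy : HasDerivWithinAt y y' S s) :
    HasDerivWithinAt (fun r => nsq (y r)) (2 * (star (y s) ⬝ᵥ y').re) S s := by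
  have h := hasDerivWithinAt_star_dotProduct hy hy
  have h2 := Complex.reCLM.hasFDerivAt.comp_hasDerivWithinAt s h
  have e : (fun r => nsq (y r)) = Complex.reCLM ∘ fun r => star (y r) ⬝ᵥ y r := by
    ext r; simp [star_dotProduct_self]
  rw [e]
  refine h2.congr_deriv ?_
  rw [star_dotProduct y' (y s)]
  simp [two_mul]

/-- The indefinite form `|y₁|² - |y₂|²`. -/
noncomputable def indef (y : Fin m₁ ⊕ Fin m₂ → ℂ) : ℝ := nsq (y ∘ Sum.inl) - nsq (y ∘ Sum.inr)

lemma nsq_sum (y : Fin m₁ ⊕ Fin m₂ → ℂ) : nsq y = nsq (y ∘ Sum.inl) + nsq (y ∘ Sum.inr) := by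
  simp [nsq]

lemma neg_indef_le_nsq (y : Fin m₁ ⊕ Fin m₂ → ℂ) : -indef y ≤ nsq y := by
  rw [nsq_sum, indef]; linarith [nsq_nonneg (y ∘ Sum.inl)]

lemma continuous_indef : Continuous (indef : (Fin m₁ ⊕ Fin m₂ → ℂ) → ℝ) := by
  unfold indef nsq; fun_prop

lemma jMat_mul_jMat : jMat m₁ m₂ * jMat m₁ m₂ = 1 := by
  simp [jMat, fromBlocks_multiply]

lemma jMat_conjTranspose : (jMat m₁ m₂)ᴴ = jMat m₁ m₂ := by
  simp [jMat, fromBlocks_conjTranspose]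

lemma potential_conjTranspose (v : Matrix (Fin m₁) (Fin m₂) ℂ) :
    (potential v)ᴴ = potential v := by
  simp [potential, fromBlocks_conjTranspose]

lemma jMat_mul_potential (v : Matrix (Fin m₁) (Fin m₂) ℂ) :
    jMat m₁ m₂ * potential v = -(potential v * jMat m₁ m₂) := by
  simp [jMat, potential, fromBlocks_multiply, fromBlocks_neg]

lemma jMat_mulVec_inl (y : Fin m₁ ⊕ Fin m₂ → ℂ) : (jMat m₁ m₂ *ᵥ y) ∘ Sum.inl = y ∘ Sum.inl := by
  simp [jMat, fromBlocks_mulVec]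

lemma jMat_mulVec_inr (y : Fin m₁ ⊕ Fin m₂ → ℂ) : (jMat m₁ m₂ *ᵥ y) ∘ Sum.inr = -(y ∘ Sum.inr) := by
  simp [jMat, fromBlocks_mulVec, neg_mulVec]

lemma star_dotProduct_sum (x y : Fin m₁ ⊕ Fin m₂ → ℂ) :
    star x ⬝ᵥ y = star (x ∘ Sum.inl) ⬝ᵥ (y ∘ Sum.inl) + star (x ∘ Sum.inr) ⬝ᵥ (y ∘ Sum.inr) := by
  simp [dotProduct]

lemma hasDerivWithinAt_indef {y : ℝ → Fin m₁ ⊕ Fin m₂ → ℂ} {y' : Fin m₁ ⊕ Fin m₂ → ℂ}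
    {S : Set ℝ} {s : ℝ} (hy : HasDerivWithinAt y y' S s) :
    HasDerivWithinAt (fun r => indef (y r)) (2 * (star (y s) ⬝ᵥ (jMat m₁ m₂ *ᵥ y')).re) S s := by
  rw [hasDerivWithinAt_pi] at hy
  have h₁ := hasDerivWithinAt_nsq (y := fun r => y r ∘ Sum.inl) (y' := y' ∘ Sum.inl)
    (hasDerivWithinAt_pi.2 fun i => hy (Sum.inl i))
  have h₂ := hasDerivWithinAt_nsq (y := fun r => y r ∘ Sum.inr) (y' := y' ∘ Sum.inr)
    (hasDerivWithinAt_pi.2 fun i => hy (Sum.inr i))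
  refine (h₁.sub h₂).congr_deriv ?_
  rw [star_dotProduct_sum, jMat_mulVec_inl, jMat_mulVec_inr]
  simp; ring

lemma indef_midpoint (x y : Fin m₁ ⊕ Fin m₂ → ℂ) :
    indef (x + y) + indef (x - y) = 2 * indef x + 2 * indef y := by
  have h (ι : Type) [Fintype ι] (a b : ι → ℂ) :
      nsq (a + b) + nsq (a - b) = 2 * nsq a + 2 * nsq b := by
    have := parallelogram_law_with_norm ℂ (WithLp.toLp 2 a) (WithLp.toLp 2 b)
    simp only [nsq_eq_norm_sq, WithLp.toLp_add, WithLp.toLp_sub]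
    linarith
  have h₁ := h _ (x ∘ Sum.inl) (y ∘ Sum.inl)
  have h₂ := h _ (x ∘ Sum.inr) (y ∘ Sum.inr)
  have e₁ : (x + y) ∘ (Sum.inl : Fin m₁ → _) = x ∘ Sum.inl + y ∘ Sum.inl := rfl
  have e₂ : (x + y) ∘ (Sum.inr : Fin m₂ → _) = x ∘ Sum.inr + y ∘ Sum.inr := rfl
  have e₃ : (x - y) ∘ (Sum.inl : Fin m₁ → _) = x ∘ Sum.inl - y ∘ Sum.inl := rfl
  have e₄ : (x - y) ∘ (Sum.inr : Fin m₂ → _) = x ∘ Sum.inr - y ∘ Sum.inr := rfl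
  simp only [indef, e₁, e₂, e₃, e₄]
  linarith

lemma sqrt_nsq_mulVec_le {m n : ℕ} (A : Matrix (Fin m) (Fin n) ℂ) (y : Fin n → ℂ) :
    √(nsq (A *ᵥ y)) ≤ opNorm A * √(nsq y) := by
  rw [sqrt_nsq, sqrt_nsq]
  exact l2_opNorm_mulVec A (WithLp.toLp 2 y)

lemma opNorm_nonneg {m n : ℕ} (A : Matrix (Fin m) (Fin n) ℂ) : 0 ≤ opNorm A := by
  open scoped Matrix.Norms.L2Operator in exact norm_nonneg A

lemma norm_star_dotProduct_mulVec_le {m n : ℕ} (A : Matrix (Fin m) (Fin n) ℂ)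
    (x : Fin m → ℂ) (y : Fin n → ℂ) :
    ‖star x ⬝ᵥ (A *ᵥ y)‖ ≤ opNorm A * (√(nsq x) * √(nsq y)) := by
  have h := norm_star_dotProduct_le x (A *ᵥ y)
  have := mul_le_mul_of_nonneg_left (sqrt_nsq_mulVec_le A y) (Real.sqrt_nonneg (nsq x))
  linarith

lemma potential_mulVec (v : Matrix (Fin m₁) (Fin m₂) ℂ) (y : Fin m₁ ⊕ Fin m₂ → ℂ) :
    potential v *ᵥ y = Sum.elim (v *ᵥ (y ∘ Sum.inr)) (vᴴ *ᵥ (y ∘ Sum.inl)) := by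
  simp [potential, fromBlocks_mulVec]

lemma star_dotProduct_conjTranspose_mulVec {m n : ℕ} (A : Matrix (Fin m) (Fin n) ℂ)
    (x : Fin m → ℂ) (y : Fin n → ℂ) :
    star y ⬝ᵥ (Aᴴ *ᵥ x) = star (star x ⬝ᵥ (A *ᵥ y)) := by
  rw [star_dotProduct, star_mulVec, ← dotProduct_mulVec, conjTranspose_conjTranspose]

/-- `y* V y` is bounded by `‖v‖ |y|²`. -/
lemma abs_re_potential_le (v : Matrix (Fin m₁) (Fin m₂) ℂ) (y : Fin m₁ ⊕ Fin m₂ → ℂ) :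
    |(star y ⬝ᵥ (potential v *ᵥ y)).re| ≤ opNorm v * nsq y := by
  have e : star y ⬝ᵥ (potential v *ᵥ y) = star (y ∘ Sum.inl) ⬝ᵥ (v *ᵥ (y ∘ Sum.inr)) +
      star (star (y ∘ Sum.inl) ⬝ᵥ (v *ᵥ (y ∘ Sum.inr))) := by
    rw [star_dotProduct_sum, potential_mulVec, ← star_dotProduct_conjTranspose_mulVec]; rfl
  have h := norm_star_dotProduct_mulVec_le v (y ∘ Sum.inl) (y ∘ Sum.inr)
  have h' := (Complex.abs_re_le_norm _).trans h
  rw [e]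
  simp only [Complex.add_re, Complex.star_def, Complex.conj_re, ← two_mul, abs_mul, abs_two]
  have hx := Real.sq_sqrt (nsq_nonneg (y ∘ (Sum.inl : Fin m₁ → _)))
  have hy := Real.sq_sqrt (nsq_nonneg (y ∘ (Sum.inr : Fin m₂ → _)))
  rw [nsq_sum]
  set p := √(nsq (y ∘ (Sum.inl : Fin m₁ → _)))
  set r := √(nsq (y ∘ (Sum.inr : Fin m₂ → _)))
  rw [← hx, ← hy]
  nlinarith [mul_nonneg (opNorm_nonneg v)
    (sq_nonneg (p - r))]

end Forms

/-! ### Linear differential equations on the half-line: existence, Grönwall, uniqueness. -/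

section LinearODE

variable {𝔸 : Type*} [NormedRing 𝔸] [NormedAlgebra ℝ 𝔸]

/-- Terms of the Peano series of `Y' = A Y`, `Y 0 = 1`. -/
noncomputable def peano (A : ℝ → 𝔸) : ℕ → ℝ → 𝔸
  | 0 => fun _ => 1
  | n + 1 => fun x => ∫ s in (0 : ℝ)..x, A s * peano A n s

lemma continuous_peano {A : ℝ → 𝔸} (hA : Continuous A) (n : ℕ) : Continuous (peano A n) := by
  induction n with
  | zero => exact continuous_const
  | succ n ih =>
    exact intervalIntegral.continuous_primitive (μ := MeasureTheory.volume)
      (fun a b => (hA.mul ih).intervalIntegrable a b) 0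

lemma hasDerivAt_peano_succ [CompleteSpace 𝔸] {A : ℝ → 𝔸} (hA : Continuous A) (n : ℕ) (x : ℝ) :
    HasDerivAt (peano A (n + 1)) (A x * peano A n x) x :=
  intervalIntegral.integral_hasDerivAt_right
    ((hA.mul (continuous_peano hA n)).intervalIntegrable _ _)
    ((hA.mul (continuous_peano hA n)).stronglyMeasurableAtFilter _ _)
    (hA.mul (continuous_peano hA n)).continuousAt

lemma norm_peano_le [CompleteSpace 𝔸] {A : ℝ → 𝔸} (hA : Continuous A) {X K : ℝ} (hX : 0 ≤ X) (hK : 0 ≤ K)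
    (hAK : ∀ s ∈ Icc (-X) X, ‖A s‖ ≤ K) (n : ℕ) :
    ∀ x ∈ Icc (-X) X, ‖peano A n x‖ ≤ (K * |x|) ^ n / n.factorial * ‖(1 : 𝔸)‖ := by
  induction n with
  | zero => intro x _; simp [peano]
  | succ n ih =>
    intro x hx
    have hsub : ∀ s ∈ uIoc 0 x, s ∈ Icc (-X) X := fun s hs =>
      (uIcc_subset_Icc (by constructor <;> linarith) hx) (uIoc_subset_uIcc hs)
    calc ‖peano A (n + 1) x‖ ≤ ∫ s in uIoc 0 x, ‖A s * peano A n s‖ :=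
          intervalIntegral.norm_integral_le_integral_norm_uIoc
      _ ≤ ∫ s in uIoc 0 x, K * (K ^ n / n.factorial * ‖(1 : 𝔸)‖) * |s - 0| ^ n := by
          refine MeasureTheory.setIntegral_mono_on ?_ ?_ measurableSet_uIoc fun s hs => ?_
          · exact ((hA.mul (continuous_peano hA n)).norm.intervalIntegrable 0 x).def'
          · exact (Continuous.intervalIntegrable (by fun_prop) 0 x).def'
          · refine (norm_mul_le _ _).trans ((mul_le_mul (hAK s (hsub s hs)) (ih s (hsub s hs))
              (norm_nonneg _) hK).trans_eq ?_)
            rw [sub_zero]; ring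
      _ = (K * |x|) ^ (n + 1) / (n + 1).factorial * ‖(1 : 𝔸)‖ := by
          rw [MeasureTheory.integral_const_mul, integral_pow_abs_sub_uIoc, Nat.factorial_succ]
          push_cast
          have := Nat.factorial_ne_zero n
          field_simp
          rw [sub_zero]; ring

/-- Global existence for linear differential equations on the half-line. -/
theorem exists_fundamental [CompleteSpace 𝔸] {A : ℝ → 𝔸} (hA : ContinuousOn A (Ici 0)) :
    ∃ Y : ℝ → 𝔸, Y 0 = 1 ∧ ∀ s ≥ 0, HasDerivWithinAt Y (A s * Y s) (Ici 0) s := by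
  -- Freezing the coefficient to the left of `0` makes it continuous on the whole line, so the
  -- series can be differentiated termwise on an open interval around `s`, including `s = 0`.
  set B : ℝ → 𝔸 := fun s => A (max s 0) with hBdef
  have hB : Continuous B := hA.comp_continuous (by fun_prop) fun s => le_max_right s 0
  refine ⟨fun x => ∑' n, peano B n x, ?_, fun s hs => ?_⟩
  · refine (tsum_eq_single 0 fun n hn => ?_).trans rfl
    · obtain ⟨k, rfl⟩ := Nat.exists_eq_succ_of_ne_zero hn
      simp [peano]
  · set X := s + 1
    obtain ⟨K, hK⟩ := (isCompact_Icc (a := -X) (b := X)).exists_bound_of_continuousOn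
      hB.continuousOn
    have hK0 : 0 ≤ K := (norm_nonneg _).trans (hK 0 (by constructor <;> simp [X] <;> linarith))
    have hX : 0 ≤ X := by simp only [X]; linarith
    have hb : ∀ n, ∀ x ∈ Icc (-X) X,
        ‖peano B n x‖ ≤ (K * X) ^ n / n.factorial * ‖(1 : 𝔸)‖ := fun n x hx => by
      refine (norm_peano_le hB hX hK0 hK n x hx).trans ?_
      have : |x| ≤ X := abs_le.2 hx
      gcongr
    have hsum : Summable fun n : ℕ => (K * X) ^ n / n.factorial * ‖(1 : 𝔸)‖ :=
      (Real.summable_pow_div_factorial _).mul_right _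
    have hs' : s ∈ Ioo (-X) X := by constructor <;> simp only [X] <;> linarith
    have hsI := Ioo_subset_Icc_self hs'
    have hP : Summable fun n => peano B n s := Summable.of_norm_bounded hsum fun n => hb n s hsI
    set g' : ℕ → ℝ → 𝔸 := fun n => n.casesOn (fun _ => 0) fun k x => B x * peano B k x
    have hu : Summable fun n : ℕ => n.casesOn (motive := fun _ => ℝ) 0
        fun k => K * ((K * X) ^ k / k.factorial * ‖(1 : 𝔸)‖) :=
      (summable_nat_add_iff 1).1 (hsum.mul_left K)
    have key := hasDerivAt_tsum_of_isPreconnected (g := peano B) (g' := g') hu isOpen_Ioo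
      isPreconnected_Ioo (fun n x _ => ?_) (fun n x hx => ?_) hs' hP hs'
    · have e : ∑' n, g' n s = A s * ∑' n, peano B n s := by
        have hg : Summable fun n => g' n s := (summable_nat_add_iff 1).1 (hP.mul_left (B s))
        rw [hg.tsum_eq_zero_add]
        simp only [g']
        rw [hP.tsum_mul_left, hBdef]
        simp [max_eq_left hs]
      rw [e] at key
      exact key.hasDerivWithinAt
    · cases n with
      | zero => exact hasDerivAt_const x 1
      | succ k => exact hasDerivAt_peano_succ hB k x
    · cases n with
      | zero => simp [g']
      | succ k =>
        have hx' := Ioo_subset_Icc_self hx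
        exact (norm_mul_le _ _).trans (mul_le_mul (hK x hx') (hb k x hx') (norm_nonneg _) hK0)

/-- Grönwall's inequality for inhomogeneous linear equations. -/
theorem norm_le_of_linear {A D e : ℝ → 𝔸} {X K ε δ : ℝ} (hK : 1 ≤ K) (hε : 0 ≤ ε) (hδ : 0 ≤ δ)
    (hD : ∀ s ∈ Icc 0 X, HasDerivWithinAt D (A s * D s + e s) (Ici 0) s)
    (hA : ∀ s ∈ Icc 0 X, ‖A s‖ ≤ K) (he : ∀ s ∈ Icc 0 X, ‖e s‖ ≤ ε) (h0 : ‖D 0‖ ≤ δ) :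
    ∀ x ∈ Icc 0 X, ‖D x‖ ≤ (δ + ε) * Real.exp (K * X) := by
  intro x hx
  have h := norm_le_gronwallBound_of_norm_deriv_right_le (f := D) (δ := δ) (K := K) (ε := ε)
    (fun s hs => ((hD s hs).continuousWithinAt).mono Icc_subset_Ici_self)
    (fun s hs => (hD s (Ico_subset_Icc_self hs)).mono (Ici_subset_Ici.2 hs.1)) h0
    (fun s hs => ?_) x hx
  · rw [gronwallBound_of_K_ne_0 (by linarith), sub_zero] at h
    have h1 : Real.exp (K * x) ≤ Real.exp (K * X) :=
      Real.exp_le_exp.2 (mul_le_mul_of_nonneg_left hx.2 (by linarith))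
    have h2 : 1 ≤ Real.exp (K * x) := Real.one_le_exp (mul_nonneg (by linarith) hx.1)
    -- The normalization `1 ≤ K` is used here: it removes the quotient from the Grönwall bound.
    have h3 : ε / K ≤ ε := div_le_self hε hK
    have h4 : ε / K * (Real.exp (K * x) - 1) ≤ ε * Real.exp (K * X) :=
      mul_le_mul h3 (by linarith) (by linarith) hε
    have h5 := mul_le_mul_of_nonneg_left h1 hδ
    linarith
  · have hs' := Ico_subset_Icc_self hs
    refine (norm_add_le _ _).trans (add_le_add ((norm_mul_le _ _).trans ?_) (he s hs'))
    exact mul_le_mul_of_nonneg_right (hA s hs') (norm_nonneg _)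

lemma exists_norm_le_on_Icc {E : Type*} [SeminormedAddCommGroup E] {A : ℝ → E} (hA : ContinuousOn A (Ici 0)) (X : ℝ) :
    ∃ K, 1 ≤ K ∧ ∀ s ∈ Icc 0 X, ‖A s‖ ≤ K := by
  obtain ⟨K, hK⟩ := (isCompact_Icc (a := 0) (b := X)).exists_bound_of_continuousOn
    (hA.mono Icc_subset_Ici_self)
  exact ⟨max K 1, le_max_right _ _, fun s hs => (hK s hs).trans (le_max_left _ _)⟩

theorem fundamental_unique {A Y Z : ℝ → 𝔸} (hA : ContinuousOn A (Ici 0))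
    (hY : ∀ s ≥ 0, HasDerivWithinAt Y (A s * Y s) (Ici 0) s)
    (hZ : ∀ s ≥ 0, HasDerivWithinAt Z (A s * Z s) (Ici 0) s) (h0 : Y 0 = Z 0) :
    ∀ s ≥ 0, Y s = Z s := by
  intro s hs
  obtain ⟨K, hK1, hK⟩ := exists_norm_le_on_Icc hA s
  have := norm_le_of_linear (D := Y - Z) (e := 0) (A := A) hK1 le_rfl le_rfl
    (fun r hr => (((hY r hr.1).sub (hZ r hr.1)).congr_deriv (by simp [mul_sub])))
    hK (by simp) (by simp [h0]) s ⟨hs, le_rfl⟩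
  simpa [sub_eq_zero] using this

end LinearODE

/-! ### Holomorphic dependence of fundamental solutions on the spectral parameter. -/

section Holomorphic

open Matrix
open scoped Matrix.Norms.L2Operator

variable {n : Type*} [Fintype n] [DecidableEq n]

lemma hasDerivWithinAt_matrix {m n : Type*} [Fintype m] [Fintype n]
    {f : ℝ → Matrix m n ℂ} {f' : Matrix m n ℂ} {S : Set ℝ} {s : ℝ} :
    HasDerivWithinAt f f' S s ↔ ∀ i k, HasDerivWithinAt (fun r => f r i k) (f' i k) S s := by
  have := hasDerivWithinAt_pi (φ := f) (φ' := f') (s := S) (x := s)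
  refine Iff.trans this (forall_congr' fun i => ?_)
  exact hasDerivWithinAt_pi

/-- The variation of the fundamental solution of `Y' = (A + z C) Y` with respect to `z`. -/
theorem exists_variation {A : ℝ → Matrix n n ℂ} (hA : ContinuousOn A (Ici 0)) (C : Matrix n n ℂ)
    {Y : ℝ → Matrix n n ℂ} (hY0 : Y 0 = 1)
    (hY : ∀ s ≥ 0, HasDerivWithinAt Y (A s * Y s) (Ici 0) s) :
    ∃ U : ℝ → Matrix n n ℂ, U 0 = 0 ∧
      ∀ s ≥ 0, HasDerivWithinAt U (A s * U s + C * Y s) (Ici 0) s := by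
  -- The inhomogeneous equation is the upper right block of a homogeneous block triangular system,
  -- so the existence theorem applies without variation of constants.
  have hB : ContinuousOn (fun s => fromBlocks (A s) C 0 (A s)) (Ici 0) := by
    have : Continuous fun M : Matrix n n ℂ => fromBlocks M C 0 M :=
      continuous_id.matrix_fromBlocks continuous_const continuous_const continuous_id
    exact this.comp_continuousOn hA
  obtain ⟨Z, hZ0, hZ⟩ := exists_fundamental hB
  have hb (s : ℝ) : fromBlocks (A s) C 0 (A s) * Z s =
      fromBlocks (A s * (Z s).toBlocks₁₁ + C * (Z s).toBlocks₂₁)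
        (A s * (Z s).toBlocks₁₂ + C * (Z s).toBlocks₂₂)
        (A s * (Z s).toBlocks₂₁) (A s * (Z s).toBlocks₂₂) := by
    conv_lhs => rw [← fromBlocks_toBlocks (Z s), fromBlocks_multiply]
    simp
  have hZ' : ∀ s ≥ 0, ∀ i k, HasDerivWithinAt (fun r => Z r i k)
      ((fromBlocks (A s * (Z s).toBlocks₁₁ + C * (Z s).toBlocks₂₁)
        (A s * (Z s).toBlocks₁₂ + C * (Z s).toBlocks₂₂)
        (A s * (Z s).toBlocks₂₁) (A s * (Z s).toBlocks₂₂)) i k) (Ici 0) s := fun s hs i k => by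
    have := hZ s hs
    rw [hb] at this
    exact hasDerivWithinAt_matrix.1 this i k
  have h22 : ∀ s ≥ 0, (Z s).toBlocks₂₂ = Y s := by
    refine fundamental_unique (Y := fun s => (Z s).toBlocks₂₂) hA (fun s hs => ?_) hY ?_
    · exact hasDerivWithinAt_matrix.2 fun i k => hZ' s hs (Sum.inr i) (Sum.inr k)
    · simp only [hZ0, hY0]
      rw [← fromBlocks_one, toBlocks_fromBlocks₂₂]
  refine ⟨fun s => (Z s).toBlocks₁₂, ?_, fun s hs => ?_⟩
  · simp only [hZ0]
    rw [← fromBlocks_one, toBlocks_fromBlocks₁₂]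
  · rw [← h22 s hs]
    exact hasDerivWithinAt_matrix.2 fun i k => hZ' s hs (Sum.inl i) (Sum.inr k)

/-- The fundamental solution of `Y' = (B + z C) Y` is an entire function of `z`. -/
theorem differentiable_fundamental {B : ℝ → Matrix n n ℂ} (hB : ContinuousOn B (Ici 0))
    (C : Matrix n n ℂ) {Y : ℝ → ℂ → Matrix n n ℂ} (hY0 : ∀ z, Y 0 z = 1)
    (hY : ∀ z, ∀ s ≥ 0, HasDerivWithinAt (fun r => Y r z) ((B s + z • C) * Y s z) (Ici 0) s)
    {s : ℝ} (hs : 0 ≤ s) : Differentiable ℂ fun z => Y s z := by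
  intro z₀
  have hAz (z : ℂ) : ContinuousOn (fun s => B s + z • C) (Ici 0) := hB.add continuousOn_const
  obtain ⟨U, hU0, hU⟩ := exists_variation (hAz z₀) C (hY0 z₀) (hY z₀)
  obtain ⟨K, hK1, hK⟩ := exists_norm_le_on_Icc hB s
  obtain ⟨N, hN1, hN⟩ := exists_norm_le_on_Icc (fun r hr => (hU r hr).continuousWithinAt) s
  have hKN : 0 ≤ ‖C‖ * N := mul_nonneg (norm_nonneg _) (by linarith)
  have key : ∀ z ∈ Metric.ball z₀ 1, ‖Y s z - Y s z₀ - (z - z₀) • U s‖ ≤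
      (‖C‖ * N * Real.exp ((K + (‖z₀‖ + 1) * ‖C‖) * s)) * ‖(z - z₀) ^ 2‖ := fun z hz => by
    have hz' : ‖z‖ ≤ ‖z₀‖ + 1 := by
      have := norm_le_norm_add_norm_sub z₀ z
      rw [mem_ball_iff_norm, norm_sub_rev] at hz
      linarith
    -- The Taylor remainder solves the system at `z` with source `(z - z₀)² C U`, hence is
    -- quadratically small.
    refine (norm_le_of_linear (A := fun s => B s + z • C)
      (D := fun r => Y r z - Y r z₀ - (z - z₀) • U r)
      (e := fun r => ((z - z₀) ^ 2) • (C * U r)) (X := s) (K := K + (‖z₀‖ + 1) * ‖C‖)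
      (ε := ‖(z - z₀) ^ 2‖ * (‖C‖ * N)) (δ := 0)
      ?_ (mul_nonneg (norm_nonneg _) hKN) le_rfl
      (fun r hr => (((hY z r hr.1).sub (hY z₀ r hr.1)).sub
        ((hU r hr.1).const_smul (z - z₀))).congr_deriv ?_)
      (fun r hr => ?_) (fun r hr => ?_) ?_ s ⟨hs, le_rfl⟩).trans_eq (by ring)
    · have := mul_nonneg (add_nonneg (norm_nonneg z₀) zero_le_one) (norm_nonneg C)
      linarith
    · have e : z • C = z₀ • C + (z - z₀) • C := by rw [← add_smul]; simp
      generalize z - z₀ = d at e ⊢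
      simp only [e, add_mul, mul_sub, smul_mul_assoc, mul_smul_comm, smul_add, pow_two, mul_smul]
      abel
    · refine (norm_add_le _ _).trans (add_le_add (hK r hr) ?_)
      rw [norm_smul]
      exact mul_le_mul_of_nonneg_right hz' (norm_nonneg _)
    · rw [norm_smul]
      exact mul_le_mul_of_nonneg_left ((norm_mul_le _ _).trans
        (mul_le_mul_of_nonneg_left (hN r hr) (norm_nonneg _))) (norm_nonneg _)
    · simp [hY0, hU0]
  have hder : HasDerivAt (fun z => Y s z) (U s) z₀ := by
    rw [hasDerivAt_iff_isLittleO]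
    refine Asymptotics.IsBigO.trans_isLittleO (Asymptotics.IsBigO.of_bound _
      (eventually_of_mem (Metric.ball_mem_nhds z₀ one_pos) key)) ?_
    exact Asymptotics.isLittleO_norm_left.1 (by
      simpa only [norm_pow] using Asymptotics.isLittleO_pow_sub_sub z₀ one_lt_two)
  exact hder.differentiableAt

end Holomorphic

/-! ### Weyl discs of a dissipative system. -/

section Discs

open Matrix

variable {m₁ m₂ : ℕ}

lemma hasDerivWithinAt_mulVec {m n : Type*} [Fintype m] [Fintype n] {Y : ℝ → Matrix m n ℂ}
    {Y' : Matrix m n ℂ} {S : Set ℝ} {s : ℝ} (hY : HasDerivWithinAt Y Y' S s) (g : n → ℂ) :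
    HasDerivWithinAt (fun r => Y r *ᵥ g) (Y' *ᵥ g) S s := by
  rw [hasDerivWithinAt_matrix] at hY
  refine hasDerivWithinAt_pi.2 fun i => ?_
  exact HasDerivWithinAt.fun_sum fun k _ => (hY i k).mul_const (g k)

/-- `Y` is the fundamental solution of `Y' = A Y` on the half-line. -/
def IsFundamental (A Y : ℝ → BlockMat m₁ m₂) : Prop :=
  Y 0 = 1 ∧ ∀ s ≥ 0, HasDerivWithinAt Y (A s * Y s) (Ici 0) s

/-- The form `|y₁|² - |y₂|²` decreases at rate at least `κ |y|²` along `y' = A y`. -/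
def IsDissipative (κ : ℝ) (A : ℝ → BlockMat m₁ m₂) : Prop :=
  ∀ s ≥ 0, ∀ y : Fin m₁ ⊕ Fin m₂ → ℂ,
    2 * (star y ⬝ᵥ (jMat m₁ m₂ *ᵥ (A s *ᵥ y))).re ≤ -κ * nsq y

variable {A Y : ℝ → BlockMat m₁ m₂} {κ : ℝ}

lemma IsFundamental.hasDerivWithinAt (hY : IsFundamental A Y) (g : Fin m₁ ⊕ Fin m₂ → ℂ) {s : ℝ}
    (hs : 0 ≤ s) :
    HasDerivWithinAt (fun r => Y r *ᵥ g) (A s *ᵥ (Y s *ᵥ g)) (Ici 0) s := by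
  rw [mulVec_mulVec]
  exact hasDerivWithinAt_mulVec (hY.2 s hs) g

lemma IsFundamental.continuousOn (hY : IsFundamental A Y) (g : Fin m₁ ⊕ Fin m₂ → ℂ) :
    ContinuousOn (fun r => Y r *ᵥ g) (Ici 0) := fun _ hs =>
  (hY.hasDerivWithinAt g hs).continuousWithinAt

lemma antitoneOn_Ici_of_hasDerivWithinAt {f f' : ℝ → ℝ}
    (hf : ∀ s ≥ 0, HasDerivWithinAt f (f' s) (Ici 0) s) (hf' : ∀ s ≥ 0, f' s ≤ 0) :
    AntitoneOn f (Ici 0) := by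
  refine antitoneOn_of_hasDerivWithinAt_nonpos (convex_Ici 0)
    (fun s hs => (hf s hs).continuousWithinAt) (f' := f') (fun s hs => ?_) fun s hs => ?_
  · exact (hf s (interior_subset hs)).mono interior_subset
  · exact hf' s (interior_subset hs)

lemma antitoneOn_indef (hκ : 0 ≤ κ) (hA : IsDissipative κ A) (hY : IsFundamental A Y)
    (g : Fin m₁ ⊕ Fin m₂ → ℂ) : AntitoneOn (fun s => indef (Y s *ᵥ g)) (Ici 0) :=
  antitoneOn_Ici_of_hasDerivWithinAt
    (fun s hs => hasDerivWithinAt_indef (hY.hasDerivWithinAt g hs)) fun s hs =>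
      (hA s hs _).trans (by nlinarith [nsq_nonneg (Y s *ᵥ g)])

lemma indef_elim_zero (d : Fin m₂ → ℂ) :
    indef (Sum.elim (0 : Fin m₁ → ℂ) d) = -nsq d := by
  rw [indef, Sum.elim_comp_inl, Sum.elim_comp_inr, nsq_zero, zero_sub]

/-- The form starts at `-|d|²` and only decreases, so `|y|² ≥ |d|²` for all time; dissipation then
forces a decrease at rate at least `κ |d|²`. This linear decay is what shrinks the discs. -/
lemma indef_mulVec_elim_zero_le (hκ : 0 ≤ κ) (hA : IsDissipative κ A) (hY : IsFundamental A Y)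
    (d : Fin m₂ → ℂ) {s : ℝ} (hs : 0 ≤ s) :
    indef (Y s *ᵥ Sum.elim 0 d) ≤ -((1 + κ * s) * nsq d) := by
  set g : Fin m₁ ⊕ Fin m₂ → ℂ := Sum.elim 0 d
  have h0 : indef (Y 0 *ᵥ g) = -nsq d := by rw [hY.1, one_mulVec, indef_elim_zero]
  have hanti := antitoneOn_indef hκ hA hY g
  have h : AntitoneOn (fun s => indef (Y s *ᵥ g) + κ * nsq d * s) (Ici 0) := by
    refine antitoneOn_Ici_of_hasDerivWithinAt (f' := fun s => _ + κ * nsq d * 1)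
      (fun s hs => (hasDerivWithinAt_indef (hY.hasDerivWithinAt g hs)).add
        ((hasDerivWithinAt_id s _).const_mul _)) fun s hs => ?_
    have h1 := hA s hs (Y s *ᵥ g)
    have h2 : indef (Y s *ᵥ g) ≤ -nsq d := h0 ▸ hanti self_mem_Ici hs hs
    have h3 := neg_indef_le_nsq (Y s *ᵥ g)
    have h4 : nsq d ≤ nsq (Y s *ᵥ g) := by linarith
    have h5 := mul_le_mul_of_nonneg_left h4 hκ
    linarith
  have := h self_mem_Ici hs hs
  simp only [h0, mul_zero, add_zero] at this
  linarith

/-- The diameter of the Weyl disc at `s`. -/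
lemma nsq_sub_le_of_indef_nonneg (hκ : 0 ≤ κ) (hA : IsDissipative κ A) (hY : IsFundamental A Y)
    {x : Fin m₁ → ℂ} {a b : Fin m₂ → ℂ} {s : ℝ} (hs : 0 ≤ s)
    (ha : 0 ≤ indef (Y s *ᵥ Sum.elim x a)) (hb : 0 ≤ indef (Y s *ᵥ Sum.elim x b)) :
    (1 + κ * s) * nsq (a - b) ≤ 4 * nsq x := by
  -- Parallelogram law: two nonnegative values equal half the form of the sum, at most its initial
  -- value and so at most `4 |x|²`, plus half the form of the difference, whose first component
  -- starts at zero and which is therefore very negative.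
  have h := indef_midpoint (Y s *ᵥ Sum.elim x a) (Y s *ᵥ Sum.elim x b)
  rw [← mulVec_add, ← mulVec_sub] at h
  have e : Sum.elim x a - Sum.elim x b = Sum.elim (0 : Fin m₁ → ℂ) (a - b) := by
    ext (i | i) <;> simp
  have h1 := indef_mulVec_elim_zero_le hκ hA hY (a - b) hs
  rw [e] at h
  have h2 : indef (Y s *ᵥ (Sum.elim x a + Sum.elim x b)) ≤ 4 * nsq x := by
    refine (antitoneOn_indef hκ hA hY _ self_mem_Ici hs hs).trans ?_
    simp only [hY.1, one_mulVec]
    have e' : (Sum.elim x a + Sum.elim x b) ∘ Sum.inl = (2 : ℂ) • x := by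
      ext i; simp [two_mul]
    rw [indef, e', nsq_smul]
    have := nsq_nonneg ((Sum.elim x a + Sum.elim x b) ∘ Sum.inr)
    norm_num
    linarith
  linarith

lemma mulVec_elim_inr (M : BlockMat m₁ m₂) (x : Fin m₁ → ℂ) (d : Fin m₂ → ℂ) :
    (M *ᵥ Sum.elim x d) ∘ Sum.inr = M.toBlocks₂₁ *ᵥ x + M.toBlocks₂₂ *ᵥ d := by
  conv_lhs => rw [← fromBlocks_toBlocks M, fromBlocks_mulVec]
  simp

lemma mulVec_elim_inl (M : BlockMat m₁ m₂) (x : Fin m₁ → ℂ) (d : Fin m₂ → ℂ) :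
    (M *ᵥ Sum.elim x d) ∘ Sum.inl = M.toBlocks₁₁ *ᵥ x + M.toBlocks₁₂ *ᵥ d := by
  conv_lhs => rw [← fromBlocks_toBlocks M, fromBlocks_mulVec]
  simp

/-- For `d` in the kernel, the solution started at `(0, d)` has vanishing second component at `s`,
hence nonnegative form there; but that form is at most `-|d|²`. -/
lemma isUnit_toBlocks₂₂ (hκ : 0 ≤ κ) (hA : IsDissipative κ A) (hY : IsFundamental A Y)
    {s : ℝ} (hs : 0 ≤ s) : IsUnit (Y s).toBlocks₂₂ := by
  rw [← mulVec_injective_iff_isUnit, ← coe_mulVecLin, injective_iff_map_eq_zero]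
  intro d hd
  rw [mulVecLin_apply] at hd
  have h := indef_mulVec_elim_zero_le hκ hA hY d hs
  rw [indef, mulVec_elim_inr, hd, mulVec_zero, add_zero, nsq_zero] at h
  have h1 := nsq_nonneg ((Y s *ᵥ Sum.elim 0 d) ∘ Sum.inl)
  have h2 := mul_nonneg (mul_nonneg hκ hs) (nsq_nonneg d)
  exact nsq_eq_zero (by linarith)

/-- The point of the Weyl disc at `s` whose solution has vanishing second component at `s`. -/
noncomputable def discPoint (M : BlockMat m₁ m₂) : Matrix (Fin m₂) (Fin m₁) ℂ :=
  -(M.toBlocks₂₂⁻¹ * M.toBlocks₂₁)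

/-- At `s` the second component vanishes, so the form is nonnegative; going back in `s` it can only
increase. This is the nesting of the discs: the disc point at `s` lies in every earlier disc. -/
lemma indef_discPoint_nonneg (hκ : 0 ≤ κ) (hA : IsDissipative κ A) (hY : IsFundamental A Y)
    {r s : ℝ} (hr : 0 ≤ r) (hrs : r ≤ s) (x : Fin m₁ → ℂ) :
    0 ≤ indef (Y r *ᵥ Sum.elim x (discPoint (Y s) *ᵥ x)) := by
  have hs := hr.trans hrs
  refine le_trans ?_ (antitoneOn_indef hκ hA hY _ hr hs hrs)
  have hu := (isUnit_iff_isUnit_det _).1 (isUnit_toBlocks₂₂ hκ hA hY hs)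
  simp only [indef]
  rw [mulVec_elim_inr, discPoint, neg_mulVec, mulVec_neg, mulVec_mulVec,
    mul_nonsing_inv_cancel_left _ _ hu, add_neg_cancel, nsq_zero, sub_zero]
  exact nsq_nonneg _

lemma nsq_single (k : Fin m₁) : nsq (Pi.single k 1 : Fin m₁ → ℂ) = 1 := by
  simp [nsq, Pi.single_apply, apply_ite norm]

lemma norm_sub_apply_sq_le (hκ : 0 ≤ κ) (hA : IsDissipative κ A) (hY : IsFundamental A Y)
    {φ ψ : Matrix (Fin m₂) (Fin m₁) ℂ} {s : ℝ} (hs : 0 ≤ s)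
    (hφ : ∀ x, 0 ≤ indef (Y s *ᵥ Sum.elim x (φ *ᵥ x)))
    (hψ : ∀ x, 0 ≤ indef (Y s *ᵥ Sum.elim x (ψ *ᵥ x))) (i : Fin m₂) (k : Fin m₁) :
    ‖φ i k - ψ i k‖ ^ 2 ≤ 4 / (1 + κ * s) := by
  have h := nsq_sub_le_of_indef_nonneg hκ hA hY hs (hφ (Pi.single k 1)) (hψ (Pi.single k 1))
  have hpos : 0 < 1 + κ * s := by nlinarith [mul_nonneg hκ hs]
  rw [nsq_single, mul_one] at h
  rw [le_div_iff₀ hpos, mul_comm]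
  refine le_trans (mul_le_mul_of_nonneg_left ?_ hpos.le) h
  simpa using norm_apply_sq_le_nsq (φ *ᵥ Pi.single k 1 - ψ *ᵥ Pi.single k 1) i

lemma tendsto_four_div (hκ : 0 < κ) : Tendsto (fun s : ℝ => 4 / (1 + κ * s)) atTop (𝓝 0) :=
  Tendsto.div_atTop tendsto_const_nhds
    (tendsto_atTop_add_const_left _ _ (tendsto_id.const_mul_atTop hκ))

/-- A point common to all Weyl discs is the limit of the disc points. -/
theorem tendsto_discPoint (hκ : 0 < κ) (hA : IsDissipative κ A) (hY : IsFundamental A Y)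
    {φ : Matrix (Fin m₂) (Fin m₁) ℂ}
    (hφ : ∀ s ≥ 0, ∀ x, 0 ≤ indef (Y s *ᵥ Sum.elim x (φ *ᵥ x))) :
    Tendsto (fun s => discPoint (Y s)) atTop (𝓝 φ) := by
  refine tendsto_pi_nhds.2 fun i => tendsto_pi_nhds.2 fun k => ?_
  rw [tendsto_iff_norm_sub_tendsto_zero]
  have h : Tendsto (fun s => ‖discPoint (Y s) i k - φ i k‖ ^ 2) atTop (𝓝 0) := by
    refine squeeze_zero' (Eventually.of_forall fun _ => by positivity) ?_ (tendsto_four_div hκ)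
    filter_upwards [eventually_ge_atTop 0] with s hs
    exact norm_sub_apply_sq_le hκ.le hA hY hs
      (fun x => indef_discPoint_nonneg hκ.le hA hY hs le_rfl x) (hφ s hs) i k
  simpa [Function.comp_def, Real.sqrt_sq_eq_abs] using (Real.continuous_sqrt.tendsto 0).comp h

end Discs

/-! ### Weyl functions of the Dirac system. -/

section Weyl

open Matrix MeasureTheory

variable {m₁ m₂ : ℕ}

lemma jMat_mul_auxG (z : ℂ) (v : Matrix (Fin m₁) (Fin m₂) ℂ) :
    jMat m₁ m₂ * auxG z v = Complex.I • (z • 1 + potential v) := by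
  rw [auxG, mul_smul_comm, mul_add, mul_smul_comm, ← mul_assoc, jMat_mul_jMat, one_mul]

/-- Since `j² = 1`, `j G = i (z + V)`, and the Hermitian `V` contributes only to the imaginary part.
-/
lemma re_form_auxG (z : ℂ) (v : Matrix (Fin m₁) (Fin m₂) ℂ) (y : Fin m₁ ⊕ Fin m₂ → ℂ) :
    (star y ⬝ᵥ (jMat m₁ m₂ *ᵥ (auxG z v *ᵥ y))).re = -z.im * nsq y := by
  have h : (star y ⬝ᵥ (potential v *ᵥ y)).im = 0 :=
    IsHermitian.im_star_dotProduct_mulVec_self (potential_conjTranspose v) y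
  rw [mulVec_mulVec, jMat_mul_auxG, smul_mulVec, add_mulVec, smul_mulVec, one_mulVec,
    dotProduct_smul, dotProduct_add, dotProduct_smul, star_dotProduct_self]
  simp [h]

lemma isDissipative_auxG (z : ℂ) (v : ℝ → Matrix (Fin m₁) (Fin m₂) ℂ) :
    IsDissipative (2 * z.im) fun s => auxG z (v s) := fun s _ y => by
  rw [re_form_auxG]; linarith

lemma continuous_potential :
    Continuous (potential : Matrix (Fin m₁) (Fin m₂) ℂ → BlockMat m₁ m₂) := by
  unfold potential
  exact continuous_const.matrix_fromBlocks continuous_id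
    continuous_id.matrix_conjTranspose continuous_const

lemma continuous_auxG (z : ℂ) :
    Continuous (auxG z : Matrix (Fin m₁) (Fin m₂) ℂ → BlockMat m₁ m₂) := by
  have := continuous_potential (m₁ := m₁) (m₂ := m₂)
  unfold auxG
  fun_prop

lemma continuous_auxF (z : ℂ) :
    Continuous fun p : Matrix (Fin m₁) (Fin m₂) ℂ × Matrix (Fin m₁) (Fin m₂) ℂ =>
      (auxF z p.1 p.2 : BlockMat m₁ m₂) := by
  have := continuous_potential (m₁ := m₁) (m₂ := m₂)
  unfold auxF
  fun_prop

lemma IsFundamentalSolution.isFundamental {A Y : ℝ → ℂ → BlockMat m₁ m₂}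
    (h : IsFundamentalSolution A Y) (z : ℂ) :
    IsFundamental (fun s => A s z) fun s => Y s z := h z

open scoped Matrix.Norms.L2Operator in
theorem exists_isFundamental {A : ℝ → BlockMat m₁ m₂} (hA : ContinuousOn A (Ici 0)) :
    ∃ Y, IsFundamental A Y := exists_fundamental hA

open scoped Matrix.Norms.L2Operator in
theorem IsFundamental.unique {A Y Z : ℝ → BlockMat m₁ m₂} (hA : ContinuousOn A (Ici 0))
    (hY : IsFundamental A Y) (hZ : IsFundamental A Z) : ∀ s ≥ 0, Y s = Z s :=
  fundamental_unique hA hY.2 hZ.2 (hY.1.trans hZ.1.symm)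

theorem exists_isFundamentalSolution {A : ℝ → ℂ → BlockMat m₁ m₂}
    (hA : ∀ z, ContinuousOn (fun s => A s z) (Ici 0)) : ∃ Y, IsFundamentalSolution A Y := by
  choose Y hY using fun z => exists_isFundamental (hA z)
  exact ⟨fun s z => Y z s, hY⟩

lemma fromRows_one_mulVec (φ : Matrix (Fin m₂) (Fin m₁) ℂ) (x : Fin m₁ → ℂ) :
    fromRows (1 : Matrix (Fin m₁) (Fin m₁) ℂ) φ *ᵥ x = Sum.elim x (φ *ᵥ x) := by
  rw [fromRows_mulVec, one_mulVec]

lemma star_dotProduct_gram {m n : Type*} [Fintype m] [Fintype n] (M : Matrix m n ℂ)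
    (a b : n → ℂ) : star a ⬝ᵥ ((Mᴴ * M) *ᵥ b) = star (M *ᵥ a) ⬝ᵥ (M *ᵥ b) := by
  rw [star_mulVec, ← dotProduct_mulVec, mulVec_mulVec]

/-- Square integrability forces the indefinite form to stay nonnegative. -/
theorem indef_nonneg_of_integrableOn {Y : ℝ → BlockMat m₁ m₂} {A : ℝ → BlockMat m₁ m₂} {κ : ℝ}
    (hκ : 0 ≤ κ) (hA : IsDissipative κ A) (hY : IsFundamental A Y) (g : Fin m₁ ⊕ Fin m₂ → ℂ)
    (hint : IntegrableOn (fun s => nsq (Y s *ᵥ g)) (Ioi 0)) {r : ℝ} (hr : 0 ≤ r) :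
    0 ≤ indef (Y r *ᵥ g) := by
  by_contra! hneg
  -- Once negative, the form stays below its value at `r`, so `|y|²` dominates a positive constant
  -- on a half-line.
  have hconst : IntegrableOn (fun _ : ℝ => -indef (Y r *ᵥ g)) (Ioi r) := by
    refine Integrable.mono' (hint.mono_set (Ioi_subset_Ioi hr)) aestronglyMeasurable_const ?_
    refine (ae_restrict_iff' measurableSet_Ioi).2 (Eventually.of_forall fun s hs => ?_)
    rw [Real.norm_of_nonneg (by linarith)]
    have := antitoneOn_indef hκ hA hY g hr (hr.trans (le_of_lt hs)) (le_of_lt hs)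
    linarith [neg_indef_le_nsq (Y s *ᵥ g)]
  rw [integrableOn_const_iff] at hconst
  simp at hconst
  linarith

lemma integrableOn_nsq_of_gram {M : ℝ → Matrix (Fin m₁ ⊕ Fin m₂) (Fin m₁) ℂ}
    (hM : ∀ i k, IntegrableOn (fun s => ((M s)ᴴ * M s) i k) (Ioi 0)) (x : Fin m₁ → ℂ) :
    IntegrableOn (fun s => nsq (M s *ᵥ x)) (Ioi 0) := by
  have e : (fun s => nsq (M s *ᵥ x)) =
      fun s => (∑ i, star (x i) * ∑ k, ((M s)ᴴ * M s) i k * x k).re := by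
    ext s
    have h := star_dotProduct_gram (M s) x x
    rw [star_dotProduct_self] at h
    rw [← Complex.ofReal_re (nsq (M s *ᵥ x)), ← h]
    simp [dotProduct, mulVec]
  rw [e]
  refine Integrable.re (𝕜 := ℂ) ?_
  exact integrable_finsetSum _ fun i _ => Integrable.const_mul
    (integrable_finsetSum _ fun k _ => Integrable.mul_const (hM i k) _) _

lemma continuous_star_dotProduct {ι : Type*} [Fintype ι] :
    Continuous fun p : (ι → ℂ) × (ι → ℂ) => star p.1 ⬝ᵥ p.2 := by
  unfold dotProduct
  refine continuous_finsetSum _ fun i _ => ?_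
  exact ((continuous_apply i).comp continuous_fst).star.mul
    ((continuous_apply i).comp continuous_snd)

lemma integrableOn_gram {M : ℝ → Matrix (Fin m₁ ⊕ Fin m₂) (Fin m₁) ℂ}
    (hc : ∀ x, ContinuousOn (fun s => M s *ᵥ x) (Ioi 0))
    (hM : ∀ x, IntegrableOn (fun s => nsq (M s *ᵥ x)) (Ioi 0)) (i k : Fin m₁) :
    IntegrableOn (fun s => ((M s)ᴴ * M s) i k) (Ioi 0) := by
  have e : (fun s => ((M s)ᴴ * M s) i k) =
      fun s => star (M s *ᵥ Pi.single i 1) ⬝ᵥ (M s *ᵥ Pi.single k 1) := by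
    ext s
    rw [← star_dotProduct_gram]
    simp [Pi.star_single]
  rw [e]
  have h : Integrable (fun s => nsq (M s *ᵥ Pi.single i 1) + nsq (M s *ᵥ Pi.single k 1))
    (volume.restrict (Ioi 0)) := Integrable.add (hM (Pi.single i 1)) (hM (Pi.single k 1))
  have hmeas : AEStronglyMeasurable
      (fun s => star (M s *ᵥ Pi.single i 1) ⬝ᵥ (M s *ᵥ Pi.single k 1))
      (volume.restrict (Ioi 0)) :=
    (continuous_star_dotProduct.comp_continuousOn
      ((hc (Pi.single i 1)).prodMk (hc (Pi.single k 1)))).aestronglyMeasurable measurableSet_Ioi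
  refine Integrable.mono' h hmeas (Eventually.of_forall fun s => ?_)
  have h1 := norm_star_dotProduct_le_half (M s *ᵥ Pi.single i 1) (M s *ᵥ Pi.single k 1)
  have h2 := norm_nonneg (star (M s *ᵥ Pi.single i 1) ⬝ᵥ (M s *ᵥ Pi.single k 1))
  linarith

/-- A Weyl function lies in every disc. The definition brings its own fundamental solution, so
uniqueness is used to pass to an arbitrary one. -/
theorem IsWeylFunction.indef_nonneg {v : ℝ → Matrix (Fin m₁) (Fin m₂) ℂ}
    (hv : ContinuousOn v (Ici 0)) {φ : ℂ → Matrix (Fin m₂) (Fin m₁) ℂ} (hφ : IsWeylFunction v φ)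
    {z : ℂ} (hz : 0 < z.im) {Y : ℝ → BlockMat m₁ m₂}
    (hY : IsFundamental (fun s => auxG z (v s)) Y) {s : ℝ} (hs : 0 ≤ s) (x : Fin m₁ → ℂ) :
    0 ≤ indef (Y s *ᵥ Sum.elim x (φ z *ᵥ x)) := by
  obtain ⟨u, hu, hint⟩ := hφ.2
  rw [IsFundamental.unique (A := fun s => auxG z (v s))
    ((continuous_auxG z).comp_continuousOn hv) hY (hu.isFundamental z) s hs]
  refine indef_nonneg_of_integrableOn (by linarith) (isDissipative_auxG z v) (hu.isFundamental z) _ ?_ hs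
  have := integrableOn_nsq_of_gram (hint z hz) x
  simpa only [← mulVec_mulVec, fromRows_one_mulVec] using this

/-- The integral of `|y|²` converges when the form stays bounded below. -/
theorem integrableOn_nsq {z : ℂ} (hz : 0 < z.im) {v : ℝ → Matrix (Fin m₁) (Fin m₂) ℂ}
    {Y : ℝ → BlockMat m₁ m₂} (hY : IsFundamental (fun s => auxG z (v s)) Y)
    {g : Fin m₁ ⊕ Fin m₂ → ℂ} (hg : ∀ s ≥ 0, 0 ≤ indef (Y s *ᵥ g)) :
    IntegrableOn (fun s => nsq (Y s *ᵥ g)) (Ioi 0) := by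
  have hder : ∀ s ≥ 0, HasDerivWithinAt (fun s => indef (Y s *ᵥ g))
      (-(2 * z.im) * nsq (Y s *ᵥ g)) (Ici 0) s := fun s hs =>
    (hasDerivWithinAt_indef (hY.hasDerivWithinAt g hs)).congr_deriv (by rw [re_form_auxG]; ring)
  have hanti := antitoneOn_indef (by linarith) (isDissipative_auxG z v) hY g
  -- The form is antitone and bounded below, hence convergent, so its derivative `-2 Im z |y|²` is
  -- integrable.
  have hlim := tendsto_atTop_ciInf (f := fun s => indef (Y (max s 0) *ᵥ g))
    (fun a b hab => hanti (le_max_right a 0) (le_max_right b 0) (max_le_max_right 0 hab))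
    ⟨0, by rintro _ ⟨s, rfl⟩; exact hg _ (le_max_right s 0)⟩
  have hlim' := hlim.congr' (f₂ := fun s => indef (Y s *ᵥ g)) (by
    filter_upwards [eventually_ge_atTop 0] with s hs
    rw [max_eq_left hs])
  have h := integrableOn_Ioi_deriv_of_nonpos (hder 0 le_rfl).continuousWithinAt
    (fun s hs => (hder s (le_of_lt hs)).hasDerivAt (Ici_mem_nhds hs))
    (fun s _ => by nlinarith [nsq_nonneg (Y s *ᵥ g)]) hlim'
  have h' := h.const_mul (-(2 * z.im))⁻¹
  have hne : -(2 * z.im) ≠ 0 := by linarith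
  simp only [inv_mul_cancel_left₀ hne] at h'
  exact h'

open scoped Matrix.Norms.L2Operator in
lemma differentiable_apply_of_isFundamentalSolution {v : ℝ → Matrix (Fin m₁) (Fin m₂) ℂ}
    (hv : ContinuousOn v (Ici 0)) {u : ℝ → ℂ → BlockMat m₁ m₂}
    (hu : IsFundamentalSolution (fun x z => auxG z (v x)) u) {s : ℝ} (hs : 0 ≤ s) :
    Differentiable ℂ fun z => u s z := by
  refine differentiable_fundamental (B := fun s => Complex.I • (jMat m₁ m₂ * potential (v s)))
    ?_ (Complex.I • jMat m₁ m₂) (fun z => (hu z).1) (fun z s hs => ?_) hs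
  · have := continuous_potential (m₁ := m₁) (m₂ := m₂)
    exact Continuous.comp_continuousOn (g := fun v => Complex.I • (jMat m₁ m₂ * potential v))
      (by fun_prop) hv
  · convert (hu z).2 s hs using 2
    simp only [auxG]
    rw [smul_add, smul_comm, add_comm]

open scoped Matrix.Norms.L2Operator in
lemma differentiableAt_discPoint {M : ℂ → BlockMat m₁ m₂} {z : ℂ} (hM : DifferentiableAt ℂ M z)
    (hu : IsUnit (M z).toBlocks₂₂) (i : Fin m₂) (k : Fin m₁) :
    DifferentiableAt ℂ (fun z => discPoint (M z) i k) z := by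
  have he : ∀ a b, DifferentiableAt ℂ (fun z => M z a b) z := fun a b =>
    differentiableAt_pi.1 (differentiableAt_pi.1 hM a) b
  have h22 : DifferentiableAt ℂ (fun z => (M z).toBlocks₂₂) z :=
    differentiableAt_pi.2 fun a => differentiableAt_pi.2 fun b => he (Sum.inr a) (Sum.inr b)
  have hinv : DifferentiableAt ℂ (fun z => ((M z).toBlocks₂₂)⁻¹) z := by
    simp only [nonsing_inv_eq_ringInverse]
    obtain ⟨w, hw⟩ := hu
    have := differentiableAt_inverse (𝕜 := ℂ) w.isUnit
    rw [hw] at this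
    exact this.comp z h22
  have hinv' : ∀ a b, DifferentiableAt ℂ (fun z => ((M z).toBlocks₂₂)⁻¹ a b) z := fun a b =>
    differentiableAt_pi.1 (differentiableAt_pi.1 hinv a) b
  simp only [discPoint, Matrix.neg_apply, mul_apply]
  exact (DifferentiableAt.fun_sum fun l _ => (hinv' i l).mul (he (Sum.inr l) (Sum.inl k))).neg

/-- Existence of the Weyl function of a Dirac system. -/
theorem exists_isWeylFunction {v : ℝ → Matrix (Fin m₁) (Fin m₂) ℂ} (hv : ContinuousOn v (Ici 0)) :
    ∃ φ, IsWeylFunction v φ := by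
  obtain ⟨u, hu⟩ := exists_isFundamentalSolution (A := fun x z => auxG z (v x)) fun z =>
    (continuous_auxG z).comp_continuousOn hv
  have hpos {z : ℂ} (hz : 0 < z.im) : 0 < 2 * z.im := by linarith
  have hdisc {z : ℂ} (hz : 0 < z.im) {r s : ℝ} (hr : 0 ≤ r) (hrs : r ≤ s) (x : Fin m₁ → ℂ) :=
    indef_discPoint_nonneg (hpos hz).le (isDissipative_auxG z v) (hu.isFundamental z) hr hrs x
  -- By nesting, all disc points with index at least `N` lie in the disc at `N`, whose diameter
  -- tends to zero.
  have hcauchy : ∀ z : ℂ, 0 < z.im → ∀ i k,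
      ∃ a, Tendsto (fun n : ℕ => discPoint (u n z) i k) atTop (𝓝 a) := fun z hz i k => by
    refine cauchySeq_tendsto_of_complete ?_
    refine cauchySeq_of_le_tendsto_0 (fun n : ℕ => √(4 / (1 + 2 * z.im * n))) ?_ ?_
    · intro n m N hn hm
      rw [dist_eq_norm]
      refine Real.le_sqrt_of_sq_le ?_
      exact norm_sub_apply_sq_le (hpos hz).le (isDissipative_auxG z v) (hu.isFundamental z) N.cast_nonneg
        (hdisc hz N.cast_nonneg (Nat.cast_le.2 hn)) (hdisc hz N.cast_nonneg (Nat.cast_le.2 hm)) i k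
    · have := (Real.continuous_sqrt.tendsto 0).comp
        ((tendsto_four_div (hpos hz)).comp tendsto_natCast_atTop_atTop)
      simpa [Function.comp_def] using this
  choose! φ hφ using hcauchy
  have hφ0 : ∀ z : ℂ, 0 < z.im → ∀ r ≥ 0, ∀ x,
      0 ≤ indef (u r z *ᵥ Sum.elim x (Matrix.of (φ z) *ᵥ x)) := fun z hz r hr x => by
    have hlim : Tendsto (fun n : ℕ => discPoint (u n z)) atTop (𝓝 (Matrix.of (φ z))) :=
      tendsto_pi_nhds.2 fun i => tendsto_pi_nhds.2 fun k => hφ z hz i k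
    have hc : Continuous fun M : Matrix (Fin m₂) (Fin m₁) ℂ =>
        indef (u r z *ᵥ Sum.elim x (M *ᵥ x)) := by
      refine continuous_indef.comp (Continuous.matrix_mulVec continuous_const ?_)
      refine continuous_pi fun i => ?_
      cases i with
      | inl i => exact continuous_const
      | inr i => exact (continuous_apply i).comp (continuous_id.matrix_mulVec continuous_const)
    refine ge_of_tendsto ((hc.tendsto _).comp hlim) ?_
    filter_upwards [eventually_ge_atTop ⌈r⌉₊] with n hn
    exact hdisc hz hr (Nat.ceil_le.1 hn) x
  refine ⟨fun z => Matrix.of (φ z), fun i k => ?_, u, hu, fun z hz i k => ?_⟩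
  · have hU : IsOpen {z : ℂ | 0 < z.im} := isOpen_lt continuous_const Complex.continuous_im
    refine TendstoLocallyUniformlyOn.differentiableOn (φ := atTop)
      (F := fun (n : ℕ) z => discPoint (u n z) i k) ?_ (Eventually.of_forall fun n z hz => ?_) hU
    · rw [Metric.tendstoLocallyUniformlyOn_iff]
      intro ε hε z₀ hz₀
      replace hz₀ : 0 < z₀.im := hz₀
      -- On this half-plane `2 Im z ≥ Im z₀`, so the diameters are bounded uniformly by those with
      -- `κ = Im z₀`.
      refine ⟨{z | z₀.im / 2 < z.im}, mem_nhdsWithin_of_mem_nhds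
        ((isOpen_lt continuous_const Complex.continuous_im).mem_nhds (half_lt_self hz₀)), ?_⟩
      have ht := (tendsto_four_div hz₀).comp tendsto_natCast_atTop_atTop
      filter_upwards [ht.eventually_lt_const (by positivity : 0 < ε ^ 2)] with n hn z hz
      replace hz : z₀.im / 2 < z.im := hz
      have hz' : 0 < z.im := by linarith
      have h := norm_sub_apply_sq_le (hpos hz').le (isDissipative_auxG z v) (hu.isFundamental z) n.cast_nonneg
        (hφ0 z hz' n n.cast_nonneg) (hdisc hz' n.cast_nonneg le_rfl) i k
      rw [dist_eq_norm]
      refine lt_of_pow_lt_pow_left₀ 2 hε.le (h.trans_lt (lt_of_le_of_lt ?_ hn))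
      simp only [Function.comp_apply]
      gcongr
      linarith
    · exact (differentiableAt_discPoint
        (differentiable_apply_of_isFundamentalSolution hv hu n.cast_nonneg z)
        (isUnit_toBlocks₂₂ (hpos hz).le (isDissipative_auxG z v) (hu.isFundamental z) n.cast_nonneg)
        i k).differentiableWithinAt
  · refine integrableOn_gram (fun x => ?_) (fun x => ?_) i k
    · simp only [← mulVec_mulVec, fromRows_one_mulVec]
      exact ((hu.isFundamental z).continuousOn _).mono Ioi_subset_Ici_self
    · simp only [← mulVec_mulVec, fromRows_one_mulVec]
      exact integrableOn_nsq hz (hu.isFundamental z) fun s hs => hφ0 z hz s hs x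

end Weyl

/-! ### The two auxiliary systems and their compatibility. -/

section ZeroCurvature

open Matrix

variable {m₁ m₂ : ℕ}

/-- The closed quarter-plane. -/
def quadrant : Set (ℝ × ℝ) := Ici 0 ×ˢ Ici 0

lemma uniqueDiffOn_quadrant : UniqueDiffOn ℝ quadrant :=
  (uniqueDiffOn_Ici 0).prod (uniqueDiffOn_Ici 0)

lemma hasDerivWithinAt_slice_left {f : ℝ × ℝ → ℂ} (hf : ContDiffOn ℝ 1 f quadrant) {x t : ℝ}
    (hx : 0 ≤ x) (ht : 0 ≤ t) :
    HasDerivWithinAt (fun y => f (y, t)) (fderivWithin ℝ f quadrant (x, t) (1, 0)) (Ici 0) x := by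
  have h := ((hf.differentiableOn one_ne_zero) (x, t) ⟨hx, ht⟩).hasFDerivWithinAt
  exact h.comp_hasDerivWithinAt (f := fun y => (y, t)) x
    ((hasDerivWithinAt_id x _).prodMk (hasDerivWithinAt_const x _ t)) fun y hy => ⟨hy, ht⟩

lemma hasDerivWithinAt_slice_right {f : ℝ × ℝ → ℂ} (hf : ContDiffOn ℝ 1 f quadrant) {x t : ℝ}
    (hx : 0 ≤ x) (ht : 0 ≤ t) :
    HasDerivWithinAt (fun s => f (x, s)) (fderivWithin ℝ f quadrant (x, t) (0, 1)) (Ici 0) t := by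
  have h := ((hf.differentiableOn one_ne_zero) (x, t) ⟨hx, ht⟩).hasFDerivWithinAt
  exact h.comp_hasDerivWithinAt (f := fun s => (x, s)) t
    ((hasDerivWithinAt_const t _ x).prodMk (hasDerivWithinAt_id t _)) fun y hy => ⟨hx, hy⟩

variable {v : ℝ → ℝ → Matrix (Fin m₁) (Fin m₂) ℂ}

lemma IsSolution.hasDerivWithinAt_x (hv : IsSolution v) {x t : ℝ} (hx : 0 ≤ x) (ht : 0 ≤ t) :
    HasDerivWithinAt (fun y => v y t) (partialX v x t) (Ici 0) x :=
  hasDerivWithinAt_matrix.2 fun i k =>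
    (hasDerivWithinAt_slice_left (hv.contDiff i k) hx ht).differentiableWithinAt.hasDerivWithinAt

lemma IsSolution.hasDerivWithinAt_t (hv : IsSolution v) {x t : ℝ} (hx : 0 ≤ x) (ht : 0 ≤ t) :
    HasDerivWithinAt (fun s => v x s) (partialT v x t) (Ici 0) t :=
  hasDerivWithinAt_matrix.2 fun i k =>
    (hasDerivWithinAt_slice_right (hv.contDiff i k) hx ht).differentiableWithinAt.hasDerivWithinAt

lemma IsSolution.hasDerivWithinAt_xx (hv : IsSolution v) {x t : ℝ} (hx : 0 ≤ x) (ht : 0 ≤ t) :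
    HasDerivWithinAt (fun y => partialX v y t) (partialX (partialX v) x t) (Ici 0) x :=
  hasDerivWithinAt_matrix.2 fun i k => (hv.exists_xx x hx t ht i k).hasDerivWithinAt

lemma IsSolution.continuousOn (hv : IsSolution v) :
    ContinuousOn (fun p : ℝ × ℝ => v p.1 p.2) quadrant :=
  continuousOn_pi.2 fun i => continuousOn_pi.2 fun k => (hv.contDiff i k).continuousOn

lemma IsSolution.continuousOn_partialX (hv : IsSolution v) :
    ContinuousOn (fun p : ℝ × ℝ => partialX v p.1 p.2) quadrant := by
  refine continuousOn_pi.2 fun i => continuousOn_pi.2 fun k => ?_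
  refine (((hv.contDiff i k).continuousOn_fderivWithin uniqueDiffOn_quadrant le_rfl).clm_apply
    (continuousOn_const (c := ((1 : ℝ), (0 : ℝ))))).congr fun p hp => ?_
  exact (hasDerivWithinAt_slice_left (hv.contDiff i k) hp.1 hp.2).derivWithin
    (uniqueDiffOn_Ici 0 _ hp.1)

lemma IsSolution.continuousOn_partialT (hv : IsSolution v) :
    ContinuousOn (fun p : ℝ × ℝ => partialT v p.1 p.2) quadrant := by
  refine continuousOn_pi.2 fun i => continuousOn_pi.2 fun k => ?_
  refine (((hv.contDiff i k).continuousOn_fderivWithin uniqueDiffOn_quadrant le_rfl).clm_apply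
    (continuousOn_const (c := ((0 : ℝ), (1 : ℝ))))).congr fun p hp => ?_
  exact (hasDerivWithinAt_slice_right (hv.contDiff i k) hp.1 hp.2).derivWithin
    (uniqueDiffOn_Ici 0 _ hp.2)

lemma IsSolution.continuousOn_auxF (hv : IsSolution v) (z : ℂ) :
    ContinuousOn (fun p : ℝ × ℝ => auxF z (v p.1 p.2) (partialX v p.1 p.2)) quadrant :=
  (continuous_auxF z).comp_continuousOn
    (f := fun p : ℝ × ℝ => (v p.1 p.2, partialX v p.1 p.2))
    (hv.continuousOn.prodMk hv.continuousOn_partialX)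

open scoped Matrix.Norms.L2Operator in
lemma IsSolution.continuousOn_slice (hv : IsSolution v) {t : ℝ} (ht : 0 ≤ t) :
    ContinuousOn (fun x => v x t) (Ici 0) := fun _ hx =>
  (hv.hasDerivWithinAt_x hx ht).continuousWithinAt

lemma hasDerivWithinAt_potential {f : ℝ → Matrix (Fin m₁) (Fin m₂) ℂ}
    {f' : Matrix (Fin m₁) (Fin m₂) ℂ} {S : Set ℝ} {s : ℝ} (hf : HasDerivWithinAt f f' S s) :
    HasDerivWithinAt (fun r => potential (f r)) (potential f') S s := by
  rw [hasDerivWithinAt_matrix] at hf ⊢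
  rintro (i | i) (k | k)
  · exact hasDerivWithinAt_const s S 0
  · exact hf i k
  · exact (hf k i).star
  · exact hasDerivWithinAt_const s S 0

/-- The derivative of `auxG` along a derivative `v'` of the potential. -/
noncomputable def auxG' (v' : Matrix (Fin m₁) (Fin m₂) ℂ) : BlockMat m₁ m₂ :=
  Complex.I • (jMat m₁ m₂ * potential v')

/-- The `x`-derivative of `auxF`. -/
noncomputable def auxF' (z : ℂ) (v vx vxx : Matrix (Fin m₁) (Fin m₂) ℂ) : BlockMat m₁ m₂ :=
  (-Complex.I) • (z • (jMat m₁ m₂ * potential vx)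
    - (1 / 2 : ℂ) • (Complex.I • potential vxx
      - jMat m₁ m₂ * (potential vx * potential v + potential v * potential vx)))

/-- The zero-curvature equation. -/
lemma zero_curvature (z : ℂ) {v vx vxx vt : Matrix (Fin m₁) (Fin m₂) ℂ}
    (h : (2 : ℂ) • vt = Complex.I • (vxx - (2 : ℂ) • (v * vᴴ * v))) :
    auxG' vt + auxG z v * auxF z v vx = auxF' z v vx vxx + auxF z v vx * auxG z v := by
  have hvt : vt = (Complex.I / 2) • vxx - Complex.I • (v * vᴴ * v) := by
    have := congrArg (fun M => (1 / 2 : ℂ) • M) h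
    simp only [smul_smul] at this
    norm_num at this
    rw [this]; module
  -- The lower left block of the matrix identity is governed by the adjoint of the equation.
  have hvt' : vtᴴ = -(Complex.I / 2) • vxxᴴ + Complex.I • (vᴴ * (v * vᴴ)) := by
    rw [hvt]
    simp only [conjTranspose_sub, conjTranspose_smul, conjTranspose_mul,
      conjTranspose_conjTranspose, Complex.star_def]
    simp [neg_div, show (starRingEnd ℂ) 2 = 2 from Complex.conj_ofNat 2]
  have I3 : Complex.I ^ 3 = -Complex.I := Complex.I_pow_three
  simp only [auxG', auxG, auxF, auxF', jMat, potential, sub_eq_add_neg, fromBlocks_multiply,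
    fromBlocks_smul, fromBlocks_add, fromBlocks_neg, hvt']
  congr 1 <;> (try rw [hvt]) <;>
  · simp only [Matrix.mul_zero, Matrix.zero_mul, Matrix.one_mul, Matrix.mul_one, smul_zero,
      add_zero, zero_add, sub_zero, Matrix.mul_add, Matrix.add_mul, Matrix.mul_sub,
      Matrix.smul_mul, Matrix.mul_smul, Matrix.neg_mul, Matrix.mul_neg,
      Matrix.mul_assoc, smul_neg, neg_zero, neg_neg]
    match_scalars <;> ring_nf <;> (try simp only [I3]) <;> (try ring)

open scoped Matrix.Norms.L2Operator in
lemma hasDerivWithinAt_auxG (z : ℂ) {f : ℝ → Matrix (Fin m₁) (Fin m₂) ℂ}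
    {f' : Matrix (Fin m₁) (Fin m₂) ℂ} {S : Set ℝ} {s : ℝ} (hf : HasDerivWithinAt f f' S s) :
    HasDerivWithinAt (fun r => auxG z (f r)) (auxG' f') S s :=
  (((hasDerivWithinAt_potential hf).const_mul (jMat m₁ m₂)).const_add
    (z • jMat m₁ m₂)).const_smul Complex.I

open scoped Matrix.Norms.L2Operator in
lemma hasDerivWithinAt_auxF (z : ℂ) {f g : ℝ → Matrix (Fin m₁) (Fin m₂) ℂ}
    {f' g' : Matrix (Fin m₁) (Fin m₂) ℂ} {S : Set ℝ} {s : ℝ}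
    (hf : HasDerivWithinAt f f' S s) (hg : HasDerivWithinAt g g' S s) (hfg : g s = f') :
    HasDerivWithinAt (fun r => auxF z (f r) (g r)) (auxF' z (f s) (g s) g') S s := by
  have hP := hasDerivWithinAt_potential hf
  have hQ := hasDerivWithinAt_potential hg
  have h1 := ((hP.const_mul (jMat m₁ m₂)).const_smul z).const_add (z ^ 2 • jMat m₁ m₂)
  have h2 := (hQ.const_smul Complex.I).sub ((hP.mul hP).const_mul (jMat m₁ m₂))
  have h3 := (h1.sub (h2.const_smul (1 / 2 : ℂ))).const_smul (-Complex.I)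
  rw [← hfg] at h3
  exact h3

/-- In `j F = -i z² - i z V + (i/2)(i j V_x) - (i/2) V²` the matrices `i j V_x` and `V²` are
Hermitian, the first because `j` anticommutes with `V_x`. So neither enters the real part, and `v_x`
plays no role in the estimates. -/
lemma re_form_auxF (z : ℂ) (v vx : Matrix (Fin m₁) (Fin m₂) ℂ) (y : Fin m₁ ⊕ Fin m₂ → ℂ) :
    (star y ⬝ᵥ (jMat m₁ m₂ *ᵥ (auxF z v vx *ᵥ y))).re =
      2 * z.re * z.im * nsq y + z.im * (star y ⬝ᵥ (potential v *ᵥ y)).re := by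
  set j := jMat m₁ m₂
  have hV : (star y ⬝ᵥ (potential v *ᵥ y)).im = 0 :=
    IsHermitian.im_star_dotProduct_mulVec_self (potential_conjTranspose v) y
  have hVV : (star y ⬝ᵥ ((potential v * potential v) *ᵥ y)).im = 0 :=
    IsHermitian.im_star_dotProduct_mulVec_self
      (by rw [IsHermitian, conjTranspose_mul, potential_conjTranspose]) y
  have hVx : (star y ⬝ᵥ ((Complex.I • (j * potential vx)) *ᵥ y)).im = 0 :=
    IsHermitian.im_star_dotProduct_mulVec_self
      (by rw [IsHermitian, conjTranspose_smul, conjTranspose_mul, potential_conjTranspose,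
            jMat_conjTranspose, jMat_mul_potential]; simp) y
  have e : j * auxF z v vx = (-Complex.I * z ^ 2) • 1 + (-Complex.I * z) • potential v
      + (Complex.I / 2) • (Complex.I • (j * potential vx))
      - (Complex.I / 2) • (potential v * potential v) := by
    have h1 (M : BlockMat m₁ m₂) : j * (j * M) = M := by
      rw [← mul_assoc, jMat_mul_jMat, one_mul]
    simp only [auxF, mul_smul_comm, mul_add, mul_sub]
    rw [h1, h1, jMat_mul_jMat]
    module
  rw [mulVec_mulVec, e]
  simp only [add_mulVec, sub_mulVec, smul_mulVec, dotProduct_add, dotProduct_sub,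
    dotProduct_smul, one_mulVec, star_dotProduct_self] at hVx ⊢
  generalize star y ⬝ᵥ (potential v *ᵥ y) = a at *
  generalize star y ⬝ᵥ ((potential v * potential v) *ᵥ y) = b at *
  generalize star y ⬝ᵥ ((j * potential vx) *ᵥ y) = c at *
  simp [pow_two] at hVx ⊢
  simp [hV, hVV, hVx]
  ring

/-- From `Re z ≤ -M` one gets `2 Re z |y|² + y* V y ≤ -M |y|²`; the derivative of the form is this
times `2 Im z`, and `2 Im z ≥ 1`. -/
lemma isDissipative_auxF {z : ℂ} {v vx : ℝ → Matrix (Fin m₁) (Fin m₂) ℂ} {M : ℝ} (hM : 0 ≤ M)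
    (hv : ∀ t ≥ 0, opNorm (v t) ≤ M) (him : 1 / 2 ≤ z.im) (hre : z.re ≤ -M) :
    IsDissipative M fun t => auxF z (v t) (vx t) := fun t ht y => by
  rw [re_form_auxF]
  have h := (le_abs_self _).trans (abs_re_potential_le (v t) y)
  have h2 := mul_le_mul_of_nonneg_right (hv t ht) (nsq_nonneg y)
  have h3 : 2 * z.re * nsq y + (star y ⬝ᵥ (potential (v t) *ᵥ y)).re ≤ -M * nsq y := by
    nlinarith [nsq_nonneg y]
  have h4 := mul_nonneg hM (nsq_nonneg y)
  nlinarith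

end ZeroCurvature

/-! ### From the `x`-axis to the `t`-axis. -/

section Evolution

open Matrix
open scoped Matrix.Norms.L2Operator

variable {m₁ m₂ : ℕ}

/-- Uniform continuity in the second variable, uniformly over compact sets of the first. -/
lemma exists_delta_of_continuousOn_quadrant {E : Type*} [NormedAddCommGroup E] {f : ℝ × ℝ → E}
    (hf : ContinuousOn f quadrant) (X t₀ : ℝ) {η : ℝ} (hη : 0 < η) (ht₀ : 0 ≤ t₀) :
    ∃ δ > 0, ∀ t ≥ 0, |t - t₀| < δ → ∀ x ∈ Icc 0 X, ‖f (x, t) - f (x, t₀)‖ ≤ η := by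
  have hK : IsCompact (Icc 0 X ×ˢ Icc 0 (t₀ + 1)) := isCompact_Icc.prod isCompact_Icc
  have hu := hK.uniformContinuousOn_of_continuous
    (hf.mono (prod_mono Icc_subset_Ici_self Icc_subset_Ici_self))
  obtain ⟨δ, hδ, h⟩ := Metric.uniformContinuousOn_iff.1 hu η hη
  refine ⟨min δ 1, lt_min hδ one_pos, fun t ht htt x hx => ?_⟩
  have h1 := abs_lt.1 (htt.trans_le (min_le_right _ _))
  rw [← dist_eq_norm]
  refine (h (x, t) ⟨hx, ht, by linarith⟩ (x, t₀) ⟨hx, ht₀, by linarith⟩ ?_).le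
  simpa [Prod.dist_eq, Real.dist_eq] using htt.trans_le (min_le_left δ 1)

/-- First-order Taylor estimate in the second variable, uniform over compact sets of the first. -/
lemma exists_delta_taylor {E : Type*} [NormedAddCommGroup E] [NormedSpace ℝ E] {f f' : ℝ × ℝ → E}
    (hf' : ContinuousOn f' quadrant)
    (hf : ∀ x ≥ 0, ∀ t ≥ 0, HasDerivWithinAt (fun s => f (x, s)) (f' (x, t)) (Ici 0) t)
    (X t₀ : ℝ) {η : ℝ} (hη : 0 < η) (ht₀ : 0 ≤ t₀) :
    ∃ δ > 0, ∀ t ≥ 0, |t - t₀| < δ → ∀ x ∈ Icc 0 X,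
      ‖f (x, t) - f (x, t₀) - (t - t₀) • f' (x, t₀)‖ ≤ η * |t - t₀| := by
  obtain ⟨δ, hδ, h⟩ := exists_delta_of_continuousOn_quadrant hf' X t₀ hη ht₀
  refine ⟨δ, hδ, fun t ht htt x hx => ?_⟩
  have hsub : uIcc t₀ t ⊆ Ici 0 := fun s hs => (le_min ht₀ ht).trans hs.1
  -- Mean value inequality for `f (x, s) - s f' (x, t₀)`, whose derivative is at most `η` near `t₀`.
  have := (convex_uIcc t₀ t).norm_image_sub_le_of_norm_hasDerivWithin_le
    (f := fun s => f (x, s) - s • f' (x, t₀)) (f' := fun s => f' (x, s) - (1 : ℝ) • f' (x, t₀))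
    (C := η) (fun s hs => (((hf x hx.1 s (hsub hs)).mono hsub).sub
      ((hasDerivWithinAt_id s _).smul_const _)))
    (fun s hs => by
      rw [one_smul]
      refine h s (hsub hs) (lt_of_le_of_lt ?_ htt) x hx
      exact abs_sub_left_of_mem_uIcc hs)
    left_mem_uIcc right_mem_uIcc
  rw [Real.norm_eq_abs] at this
  convert this using 2
  rw [sub_smul]; abel

/-- If `W` satisfies the `x`-equation for all `t` and the `t`-equation on the boundary `x = 0`,
then it satisfies the `t`-equation everywhere, locally uniformly in `x`. -/
theorem exists_delta_of_zero_curvature {𝔸 : Type*} [NormedRing 𝔸] [NormedAlgebra ℝ 𝔸]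
    {G G' F F' W : ℝ × ℝ → 𝔸}
    (hG' : ContinuousOn G' quadrant)
    (hGc : ContinuousOn G quadrant) (hFc : ContinuousOn F quadrant)
    (hG : ∀ x ≥ 0, ∀ t ≥ 0, HasDerivWithinAt (fun s => G (x, s)) (G' (x, t)) (Ici 0) t)
    (hF : ∀ x ≥ 0, ∀ t ≥ 0, HasDerivWithinAt (fun y => F (y, t)) (F' (x, t)) (Ici 0) x)
    (hzc : ∀ x ≥ 0, ∀ t ≥ 0, G' (x, t) + G (x, t) * F (x, t) = F' (x, t) + F (x, t) * G (x, t))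
    (hW : ∀ x ≥ 0, ∀ t ≥ 0, HasDerivWithinAt (fun y => W (y, t)) (G (x, t) * W (x, t)) (Ici 0) x)
    (hW0 : ∀ t ≥ 0, HasDerivWithinAt (fun s => W (0, s)) (F (0, t) * W (0, t)) (Ici 0) t)
    {X t₀ : ℝ} (ht₀ : 0 ≤ t₀) {ε : ℝ} (hε : 0 < ε) :
    ∃ δ > 0, ∀ t ≥ 0, |t - t₀| < δ → ∀ x ∈ Icc 0 X,
      ‖W (x, t) - W (x, t₀) - (t - t₀) • (F (x, t₀) * W (x, t₀))‖ ≤ ε * |t - t₀| := by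
  obtain ⟨K₀, hK₀⟩ := ((isCompact_Icc (a := 0) (b := X)).prod
    (isCompact_Icc (a := 0) (b := t₀ + 1))).exists_bound_of_continuousOn
    (hGc.mono (prod_mono Icc_subset_Ici_self Icc_subset_Ici_self))
  set K := max K₀ 1
  have hK1 : 1 ≤ K := le_max_right _ _
  have hslice {f : ℝ × ℝ → 𝔸} (hf : ContinuousOn f quadrant) :
      ContinuousOn (fun x => f (x, t₀)) (Ici 0) :=
    hf.comp (by fun_prop) fun x hx => ⟨hx, ht₀⟩
  have hWc : ContinuousOn (fun x => W (x, t₀)) (Ici 0) := fun x hx =>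
    (hW x hx t₀ ht₀).continuousWithinAt
  obtain ⟨N, hN1, hN⟩ := exists_norm_le_on_Icc hWc X
  obtain ⟨P, hP1, hP⟩ := exists_norm_le_on_Icc ((hslice hFc).mul hWc) X
  -- This is the factor that Grönwall produces from the three error sources below: the boundary
  -- value, the Taylor remainder of `G` and the increment of `G`.
  set c := (1 + N + P) * Real.exp (K * X)
  have hc : 0 < c := mul_pos (by linarith) (Real.exp_pos _)
  set η := ε / c
  have hη : 0 < η := div_pos hε hc
  obtain ⟨δ₁, hδ₁, h₁⟩ := exists_delta_taylor hG' hG X t₀ hη ht₀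
  obtain ⟨δ₂, hδ₂, h₂⟩ := exists_delta_of_continuousOn_quadrant hGc X t₀ hη ht₀
  obtain ⟨δ₃, hδ₃, h₃⟩ : ∃ δ > 0, ∀ t ≥ 0, |t - t₀| < δ →
      ‖W (0, t) - W (0, t₀) - (t - t₀) • (F (0, t₀) * W (0, t₀))‖ ≤ η * |t - t₀| := by
    have := (hasDerivWithinAt_iff_isLittleO.1 (hW0 t₀ ht₀)).bound hη
    obtain ⟨δ, hδ, h⟩ := Metric.mem_nhdsWithin_iff.1 this
    exact ⟨δ, hδ, fun t ht htt => h ⟨by simpa [Real.dist_eq] using htt, ht⟩⟩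
  refine ⟨min (min δ₁ δ₂) (min δ₃ 1), by positivity, fun t ht htt x hx => ?_⟩
  obtain ⟨⟨l₁, l₂⟩, l₃, l₄⟩ :
      (|t - t₀| < δ₁ ∧ |t - t₀| < δ₂) ∧ |t - t₀| < δ₃ ∧ |t - t₀| < 1 := by
    simpa only [lt_min_iff] using htt
  have h1 := abs_lt.1 l₄
  -- The remainder is propagated in `x` by the system at the time `t`, not `t₀`. Only `G` is
  -- differentiated in `t` and only `F` in `x`, so no mixed derivative of `v` is needed.
  refine (norm_le_of_linear (A := fun x => G (x, t))
    (D := fun x => W (x, t) - W (x, t₀) - (t - t₀) • (F (x, t₀) * W (x, t₀)))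
    (e := fun x => (G (x, t) - G (x, t₀) - (t - t₀) • G' (x, t₀)) * W (x, t₀)
      + (t - t₀) • ((G (x, t) - G (x, t₀)) * (F (x, t₀) * W (x, t₀))))
    (X := X) (K := K) (δ := η * |t - t₀|) (ε := η * |t - t₀| * N + |t - t₀| * (η * P))
    hK1 (by positivity) (by positivity) (fun s hs => ?_) (fun s hs => ?_) (fun s hs => ?_)
    (h₃ t ht l₃) x hx).trans_eq ?_
  · refine (((hW s hs.1 t ht).sub (hW s hs.1 t₀ ht₀)).sub
      (((hF s hs.1 t₀ ht₀).mul (hW s hs.1 t₀ ht₀)).const_smul (t - t₀))).congr_deriv ?_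
    have e1 : F' (s, t₀) * W (s, t₀) + F (s, t₀) * (G (s, t₀) * W (s, t₀)) =
        G' (s, t₀) * W (s, t₀) + G (s, t₀) * (F (s, t₀) * W (s, t₀)) := by
      rw [← mul_assoc, ← mul_assoc, ← add_mul, ← add_mul, hzc s hs.1 t₀ ht₀]
    rw [e1]
    simp only [mul_sub, sub_mul, mul_smul_comm, smul_mul_assoc, smul_add, smul_sub]
    abel
  · exact (hK₀ (s, t) ⟨hs, ht, by linarith⟩).trans (le_max_left _ _)
  · refine (norm_add_le _ _).trans (add_le_add ((norm_mul_le _ _).trans ?_) ?_)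
    · exact mul_le_mul (h₁ t ht l₁ s hs) (hN s hs) (norm_nonneg _) (by positivity)
    · rw [norm_smul, Real.norm_eq_abs]
      exact mul_le_mul_of_nonneg_left ((norm_mul_le _ _).trans
        (mul_le_mul (h₂ t ht l₂ s hs) (hP s hs) (norm_nonneg _) hη.le)) (abs_nonneg _)
  · have : ε = η * c := (div_mul_cancel₀ ε hc.ne').symm
    rw [this]
    simp only [c]
    ring

/-- Differentiation along the line `x = C (T - s)`. -/
theorem hasDerivWithinAt_line {E : Type*} [NormedAddCommGroup E] [NormedSpace ℝ E]
    {W Wx Wt : ℝ × ℝ → E} {C T : ℝ} (hC : 0 ≤ C)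
    (hx : ∀ x ≥ 0, ∀ t ≥ 0, HasDerivWithinAt (fun y => W (y, t)) (Wx (x, t)) (Ici 0) x)
    (hWt : ∀ t ≥ 0, ContinuousOn (fun x => Wt (x, t)) (Ici 0))
    (ht : ∀ X ≥ 0, ∀ t₀ ≥ 0, ∀ ε > 0, ∃ δ > 0, ∀ t ≥ 0, |t - t₀| < δ → ∀ x ∈ Icc 0 X,
      ‖W (x, t) - W (x, t₀) - (t - t₀) • Wt (x, t₀)‖ ≤ ε * |t - t₀|)
    {s₀ : ℝ} (hs₀ : s₀ ∈ Icc 0 T) :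
    HasDerivWithinAt (fun s => W (C * (T - s), s))
      (Wt (C * (T - s₀), s₀) - C • Wx (C * (T - s₀), s₀)) (Icc 0 T) s₀ := by
  have hmaps : MapsTo (fun s => C * (T - s)) (Icc 0 T) (Ici 0) := fun s hs =>
    mul_nonneg hC (by linarith [hs.2])
  have hT : 0 ≤ T := hs₀.1.trans hs₀.2
  have hline : HasDerivWithinAt (fun s => C * (T - s)) (-C) (Icc 0 T) s₀ := by
    simpa using ((hasDerivWithinAt_id s₀ (Icc 0 T)).const_sub T).const_mul C
  -- Joint differentiability of `W` is not available. The increment is split into a remainder that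
  -- is small uniformly in `x`, a linear term with merely continuous coefficient, and a pure
  -- `x`-increment.
  have f₁ : HasDerivWithinAt (fun s => W (C * (T - s), s) - W (C * (T - s), s₀)
      - (s - s₀) • Wt (C * (T - s), s₀)) 0 (Icc 0 T) s₀ := by
    rw [hasDerivWithinAt_iff_isLittleO, Asymptotics.isLittleO_iff]
    intro ε hε
    obtain ⟨δ, hδ, h⟩ := ht (C * T) (mul_nonneg hC hT) s₀ hs₀.1 ε hε
    refine Metric.mem_nhdsWithin_iff.2 ⟨δ, hδ, fun s hs => ?_⟩
    have := h s hs.2.1 (by simpa [Real.dist_eq] using hs.1) (C * (T - s))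
      ⟨hmaps hs.2, mul_le_mul_of_nonneg_left (by linarith [hs.2.1]) hC⟩
    simpa using this
  have f₂ : HasDerivWithinAt (fun s => (s - s₀) • Wt (C * (T - s), s₀))
      (Wt (C * (T - s₀), s₀)) (Icc 0 T) s₀ := by
    rw [hasDerivWithinAt_iff_tendsto_slope]
    have hc : ContinuousWithinAt (fun s => Wt (C * (T - s), s₀)) (Icc 0 T) s₀ :=
      ContinuousWithinAt.comp (f := fun s => C * (T - s)) (hWt s₀ hs₀.1 _ (hmaps hs₀))
        hline.continuousWithinAt hmaps
    refine (hc.mono sdiff_subset).congr' ?_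
    filter_upwards [self_mem_nhdsWithin] with s hs
    have : s - s₀ ≠ 0 := sub_ne_zero.2 fun h => hs.2 (by simp [h])
    simp [slope_def_module, smul_smul, inv_mul_cancel₀ this]
  have f₃ : HasDerivWithinAt (fun s => W (C * (T - s), s₀)) ((-C) • Wx (C * (T - s₀), s₀))
      (Icc 0 T) s₀ :=
    HasDerivWithinAt.scomp s₀ (h := fun s => C * (T - s)) (hx _ (hmaps hs₀) s₀ hs₀.1) hline hmaps
  refine ((f₁.add f₂).add f₃).congr_deriv ?_ |>.congr_of_mem (fun s _ => ?_) hs₀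
  · rw [zero_add, neg_smul, ← sub_eq_add_neg]
  · simp only [Pi.add_apply]
    abel

/-- The indefinite form increases along lines of sufficiently large speed. -/
lemma monotoneOn_indef_line {v vx : ℝ → ℝ → Matrix (Fin m₁) (Fin m₂) ℂ} {z : ℂ} (hz : 0 ≤ z.im)
    {W : ℝ × ℝ → BlockMat m₁ m₂} {C M T : ℝ} (hC0 : 0 < C)
    (hC : 2 * |z.re| + M ≤ C) (hM : ∀ x > 0, ∀ s ∈ Icc 0 T, opNorm (v x s) ≤ M)
    (hline : ∀ s ∈ Icc 0 T, HasDerivWithinAt (fun s => W (C * (T - s), s))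
      (auxF z (v (C * (T - s)) s) (vx (C * (T - s)) s) * W (C * (T - s), s)
        - C • (auxG z (v (C * (T - s)) s) * W (C * (T - s), s))) (Icc 0 T) s)
    (g : Fin m₁ ⊕ Fin m₂ → ℂ) :
    MonotoneOn (fun s => indef (W (C * (T - s), s) *ᵥ g)) (Icc 0 T) := by
  have hder : ∀ s ∈ Icc 0 T, HasDerivWithinAt (fun s => indef (W (C * (T - s), s) *ᵥ g)) _
    (Icc 0 T) s := fun s hs => hasDerivWithinAt_indef (hasDerivWithinAt_mulVec (hline s hs) g)
  refine monotoneOn_of_hasDerivWithinAt_nonneg (convex_Icc 0 T)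
    (fun s hs => (hder s hs).continuousWithinAt)
    (fun s hs => (hder s (interior_subset hs)).mono interior_subset) fun s hs => ?_
  rw [interior_Icc] at hs
  set x := C * (T - s)
  have hx : 0 < x := mul_pos hC0 (by linarith [hs.2])
  set y := W (x, s) *ᵥ g
  have e : (auxF z (v x s) (vx x s) * W (x, s) - C • (auxG z (v x s) * W (x, s))) *ᵥ g =
      auxF z (v x s) (vx x s) *ᵥ y - (C : ℂ) • (auxG z (v x s) *ᵥ y) := by
    rw [sub_mulVec, ← mulVec_mulVec, Complex.coe_smul, smul_mulVec, ← mulVec_mulVec]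
  rw [e, mulVec_sub, mulVec_smul, dotProduct_sub, dotProduct_smul, Complex.sub_re, smul_eq_mul,
    Complex.re_ofReal_mul, re_form_auxF, re_form_auxG]
  have h1 := neg_le_of_abs_le (abs_re_potential_le (v x s) y)
  have h2 := mul_le_mul_of_nonneg_right (hM x hx s ⟨hs.1.le, hs.2.le⟩) (nsq_nonneg y)
  have h3 := mul_le_mul_of_nonneg_right (neg_abs_le z.re) (nsq_nonneg y)
  -- The derivative of the form along the line is `2 Im z` times this quantity; the speed `C` was
  -- chosen to absorb both `2 Re z` and the potential.
  have h4 : 0 ≤ 2 * z.re * nsq y + (star y ⬝ᵥ (potential (v x s) *ᵥ y)).re + C * nsq y := by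
    have h5 := mul_le_mul_of_nonneg_right hC (nsq_nonneg y)
    linarith
  nlinarith [mul_nonneg hz h4]

/-- Nonnegativity of the indefinite form propagates from the `x`-axis to the `t`-axis, because the
form increases along lines `x = C (T - t)` of sufficiently large speed `C`. -/
theorem IsSolution.indef_nonneg {v : ℝ → ℝ → Matrix (Fin m₁) (Fin m₂) ℂ} (hv : IsSolution v)
    {z : ℂ} (hz : 0 < z.im) {u R : ℝ → BlockMat m₁ m₂}
    (hu : IsFundamental (fun x => auxG z (v x 0)) u)
    (hR : IsFundamental (fun t => auxF z (v 0 t) (partialX v 0 t)) R)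
    {g : Fin m₁ ⊕ Fin m₂ → ℂ} (hg : ∀ x ≥ 0, 0 ≤ indef (u x *ᵥ g)) {T : ℝ} (hT : 0 ≤ T) :
    0 ≤ indef (R T *ᵥ g) := by
  -- For negative `t` the value is arbitrary; this makes the choice of `U` total.
  have hslice (t : ℝ) : ∃ U, 0 ≤ t → IsFundamental (fun x => auxG z (v x t)) U := by
    by_cases ht : 0 ≤ t
    · obtain ⟨U, hU⟩ := exists_isFundamental (A := fun x => auxG z (v x t))
        ((continuous_auxG z).comp_continuousOn (hv.continuousOn_slice ht))
      exact ⟨U, fun _ => hU⟩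
    · exact ⟨0, fun h => absurd h ht⟩
  choose U hU using hslice
  set G : ℝ × ℝ → BlockMat m₁ m₂ := fun p => auxG z (v p.1 p.2)
  set F : ℝ × ℝ → BlockMat m₁ m₂ := fun p => auxF z (v p.1 p.2) (partialX v p.1 p.2)
  -- By construction `W` solves the `x`-system at each time, and the `t`-system on `x = 0` because
  -- `U` is normalized there. Zero curvature then extends the `t`-system to all `x`.
  set W : ℝ × ℝ → BlockMat m₁ m₂ := fun p => U p.2 p.1 * R p.2
  have hGc : ContinuousOn G quadrant := (continuous_auxG z).comp_continuousOn hv.continuousOn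
  have hFc : ContinuousOn F quadrant := hv.continuousOn_auxF z
  have hG'c : ContinuousOn (fun p : ℝ × ℝ => auxG' (partialT v p.1 p.2)) quadrant := by
    have : Continuous (auxG' : Matrix (Fin m₁) (Fin m₂) ℂ → BlockMat m₁ m₂) := by
      have := continuous_potential (m₁ := m₁) (m₂ := m₂)
      unfold auxG'
      fun_prop
    exact this.comp_continuousOn hv.continuousOn_partialT
  have hWx : ∀ x ≥ 0, ∀ t ≥ 0,
      HasDerivWithinAt (fun y => W (y, t)) (G (x, t) * W (x, t)) (Ici 0) x := fun x hx t ht => by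
    have h := ((hU t ht).2 x hx).mul_const (R t)
    rw [mul_assoc] at h
    exact h
  have hW0 : ∀ t ≥ 0, W (0, t) = R t := fun t ht => by
    simp only [W, (hU t ht).1, one_mul]
  have hWt0 : ∀ t ≥ 0, HasDerivWithinAt (fun s => W (0, s)) (F (0, t) * W (0, t)) (Ici 0) t :=
    fun t ht => by
      rw [hW0 t ht]
      exact (hR.2 t ht).congr_of_mem (fun s hs => hW0 s hs) ht
  have hWt : ∀ t ≥ 0, ContinuousOn (fun x => F (x, t) * W (x, t)) (Ici 0) := fun t ht =>
    (hFc.comp (f := fun x => (x, t)) (by fun_prop) fun x hx => ⟨hx, ht⟩).mul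
      fun x hx => (hWx x hx t ht).continuousWithinAt
  obtain ⟨M, hM0, hM⟩ := hv.bounded T hT
  -- The speed depends on `T`, since `v` is bounded only on each strip `0 ≤ s ≤ T`.
  set C := 2 * |z.re| + M
  have hC : 0 < C := by positivity
  have hWt' : ∀ X ≥ 0, ∀ t₀ ≥ 0, ∀ ε > 0, ∃ δ > 0, ∀ t ≥ 0, |t - t₀| < δ → ∀ x ∈ Icc 0 X,
      ‖W (x, t) - W (x, t₀) - (t - t₀) • (F (x, t₀) * W (x, t₀))‖ ≤ ε * |t - t₀| :=
    fun X _ t₀ ht₀ ε hε => exists_delta_of_zero_curvature (G := G) (F := F) (W := W)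
      (G' := fun p => auxG' (partialT v p.1 p.2))
      (F' := fun p => auxF' z (v p.1 p.2) (partialX v p.1 p.2) (partialX (partialX v) p.1 p.2))
      hG'c hGc hFc
      (fun x hx t ht => hasDerivWithinAt_auxG z (hv.hasDerivWithinAt_t hx ht))
      (fun x hx t ht => hasDerivWithinAt_auxF z (hv.hasDerivWithinAt_x hx ht)
        (hv.hasDerivWithinAt_xx hx ht) rfl)
      (fun x hx t ht => zero_curvature z (hv.equation x hx t ht)) hWx hWt0 ht₀ hε
  have hline : ∀ s ∈ Icc 0 T, HasDerivWithinAt (fun s => W (C * (T - s), s))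
      (F (C * (T - s), s) * W (C * (T - s), s) - C • (G (C * (T - s), s) * W (C * (T - s), s)))
      (Icc 0 T) s := fun s hs =>
    hasDerivWithinAt_line (W := W) (Wx := fun p => G p * W p) (Wt := fun p => F p * W p) hC.le
      hWx hWt hWt' hs
  have hmono : MonotoneOn (fun s => indef (W (C * (T - s), s) *ᵥ g)) (Icc 0 T) :=
    monotoneOn_indef_line hz.le hC le_rfl hM hline g
  have h := hmono (left_mem_Icc.2 hT) (right_mem_Icc.2 hT) hT
  simp only [sub_zero, sub_self, mul_zero, hW0 T hT] at h
  refine le_trans ?_ h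
  have e0 : W (C * T, 0) = u (C * T) := by
    simp only [W, hR.1, mul_one]
    exact (hU 0 le_rfl).unique
      ((continuous_auxG z).comp_continuousOn (hv.continuousOn_slice le_rfl)) hu _
      (mul_nonneg hC.le hT)
  rw [e0]
  exact hg _ (mul_nonneg hC.le hT)

end Evolution

/-! ### Growth estimates and duality between `z` and its conjugate. -/

section BorgMarchenko

open Matrix

variable {m₁ m₂ : ℕ}

/-- `exp (-k s) f s` is antitone. The sign of `k` is free, as needed both for growth and for decay.
-/
lemma le_exp_mul_of_deriv_le {f f' : ℝ → ℝ} {k X : ℝ} (hX : 0 ≤ X)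
    (hf : ∀ s ∈ Icc 0 X, HasDerivWithinAt f (f' s) (Ici 0) s)
    (hf' : ∀ s ∈ Icc 0 X, f' s ≤ k * f s) : f X ≤ Real.exp (k * X) * f 0 := by
  have hder : ∀ s ∈ Icc 0 X, HasDerivWithinAt (fun s => Real.exp (-k * s) * f s)
      (Real.exp (-k * s) * (-k * 1) * f s + Real.exp (-k * s) * f' s) (Icc 0 X) s := fun s hs =>
    (((hasDerivWithinAt_id s _).const_mul (-k)).exp).mul ((hf s hs).mono Icc_subset_Ici_self)
  have hanti : AntitoneOn (fun s => Real.exp (-k * s) * f s) (Icc 0 X) := by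
    refine antitoneOn_of_hasDerivWithinAt_nonpos (convex_Icc 0 X)
      (fun s hs => (hder s hs).continuousWithinAt)
      (fun s hs => (hder s (interior_subset hs)).mono interior_subset) fun s hs => ?_
    have h1 := mul_le_mul_of_nonneg_left (hf' s (interior_subset hs)) (Real.exp_pos (-k * s)).le
    linarith
  have h := hanti (left_mem_Icc.2 hX) (right_mem_Icc.2 hX) hX
  simp only [mul_zero, Real.exp_zero, one_mul] at h
  calc f X = Real.exp (k * X) * (Real.exp (-k * X) * f X) := by
        rw [← mul_assoc, ← Real.exp_add]; simp
    _ ≤ _ := mul_le_mul_of_nonneg_left h (Real.exp_pos _).le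

lemma auxG_mulVec_inl (z : ℂ) (v : Matrix (Fin m₁) (Fin m₂) ℂ) (y : Fin m₁ ⊕ Fin m₂ → ℂ) :
    (auxG z v *ᵥ y) ∘ Sum.inl =
      Complex.I • (z • (y ∘ Sum.inl) + v *ᵥ (y ∘ Sum.inr)) := by
  ext i
  simp only [auxG, smul_mulVec, add_mulVec, ← mulVec_mulVec, potential_mulVec]
  simp [jMat, fromBlocks_mulVec, Function.comp_def]
  ring

lemma auxG_mulVec_inr (z : ℂ) (v : Matrix (Fin m₁) (Fin m₂) ℂ) (y : Fin m₁ ⊕ Fin m₂ → ℂ) :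
    (auxG z v *ᵥ y) ∘ Sum.inr =
      -(Complex.I • (z • (y ∘ Sum.inr) + vᴴ *ᵥ (y ∘ Sum.inl))) := by
  ext i
  simp only [auxG, smul_mulVec, add_mulVec, ← mulVec_mulVec, potential_mulVec]
  simp [jMat, fromBlocks_mulVec, Function.comp_def, neg_mulVec]
  ring

/-- The two components are estimated separately, so that the opposite rates `∓2 Im z` coming from `i
z j` survive and the potential enters only through the coupling. -/
lemma re_inl_le (z : ℂ) (v : Matrix (Fin m₁) (Fin m₂) ℂ) (y : Fin m₁ ⊕ Fin m₂ → ℂ) :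
    2 * (star (y ∘ Sum.inl) ⬝ᵥ ((auxG z v *ᵥ y) ∘ Sum.inl)).re ≤ -2 * z.im * nsq (y ∘ Sum.inl)
      + 2 * (opNorm v * (√(nsq (y ∘ Sum.inl)) * √(nsq (y ∘ Sum.inr)))) := by
  have h := norm_star_dotProduct_mulVec_le v (y ∘ Sum.inl) (y ∘ Sum.inr)
  have h' := (Complex.abs_im_le_norm _).trans h
  rw [auxG_mulVec_inl, dotProduct_smul, dotProduct_add, dotProduct_smul, star_dotProduct_self]
  simp
  linarith [neg_le_of_abs_le h']

lemma re_inr_le (z : ℂ) (v : Matrix (Fin m₁) (Fin m₂) ℂ) (y : Fin m₁ ⊕ Fin m₂ → ℂ) :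
    2 * (star (y ∘ Sum.inr) ⬝ᵥ ((auxG z v *ᵥ y) ∘ Sum.inr)).re ≤ 2 * z.im * nsq (y ∘ Sum.inr)
      + 2 * (opNorm v * (√(nsq (y ∘ Sum.inl)) * √(nsq (y ∘ Sum.inr)))) := by
  have h := norm_star_dotProduct_mulVec_le v (y ∘ Sum.inl) (y ∘ Sum.inr)
  have h' := (Complex.abs_im_le_norm _).trans h
  rw [auxG_mulVec_inr, dotProduct_neg, dotProduct_smul, dotProduct_add, dotProduct_smul,
    star_dotProduct_self, star_dotProduct_conjTranspose_mulVec]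
  simp
  linarith [neg_le_of_abs_le h']

variable {v : ℝ → Matrix (Fin m₁) (Fin m₂) ℂ} {Y : ℝ → BlockMat m₁ m₂} {z : ℂ} {N X : ℝ}

lemma hasDerivWithinAt_comp_inl {A Y : ℝ → BlockMat m₁ m₂} (hY : IsFundamental A Y)
    (g : Fin m₁ ⊕ Fin m₂ → ℂ) {s : ℝ} (hs : 0 ≤ s) :
    HasDerivWithinAt (fun r => (Y r *ᵥ g) ∘ Sum.inl) ((A s *ᵥ (Y s *ᵥ g)) ∘ Sum.inl) (Ici 0) s :=
  hasDerivWithinAt_pi.2 fun i => hasDerivWithinAt_pi.1 (hY.hasDerivWithinAt g hs) (Sum.inl i)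

lemma hasDerivWithinAt_comp_inr {A Y : ℝ → BlockMat m₁ m₂} (hY : IsFundamental A Y)
    (g : Fin m₁ ⊕ Fin m₂ → ℂ) {s : ℝ} (hs : 0 ≤ s) :
    HasDerivWithinAt (fun r => (Y r *ᵥ g) ∘ Sum.inr) ((A s *ᵥ (Y s *ᵥ g)) ∘ Sum.inr) (Ici 0) s :=
  hasDerivWithinAt_pi.2 fun i => hasDerivWithinAt_pi.1 (hY.hasDerivWithinAt g hs) (Sum.inr i)

lemma sqrt_mul_sqrt_le (a b : ℝ) (ha : 0 ≤ a) (hb : 0 ≤ b) : 2 * (√a * √b) ≤ a + b := by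
  nlinarith [sq_nonneg (√a - √b), Real.sq_sqrt ha, Real.sq_sqrt hb]

/-- Any solution grows at most like `exp ((|Im z| + N) x)`. -/
lemma nsq_mulVec_le_exp (hY : IsFundamental (fun s => auxG z (v s)) Y) (hX : 0 ≤ X)
    (hN : ∀ s ∈ Icc 0 X, opNorm (v s) ≤ N) (g : Fin m₁ ⊕ Fin m₂ → ℂ) :
    nsq (Y X *ᵥ g) ≤ Real.exp (2 * (|z.im| + N) * X) * nsq g := by
  have h := le_exp_mul_of_deriv_le (f := fun s => nsq (Y s *ᵥ g)) (k := 2 * (|z.im| + N)) hX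
    (fun s hs => hasDerivWithinAt_nsq (hY.hasDerivWithinAt g hs.1)) fun s hs => ?_
  · simpa only [hY.1, one_mulVec] using h
  · set y := Y s *ᵥ g
    rw [star_dotProduct_sum, Complex.add_re, nsq_sum]
    have h1 := re_inl_le z (v s) y
    have h2 := re_inr_le z (v s) y
    have h3 := sqrt_mul_sqrt_le _ _ (nsq_nonneg (y ∘ Sum.inl)) (nsq_nonneg (y ∘ Sum.inr))
    have h4 := mul_le_mul_of_nonneg_left h3 (opNorm_nonneg (v s))
    have h5 := mul_le_mul_of_nonneg_right (hN s hs)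
      (add_nonneg (nsq_nonneg (y ∘ Sum.inl)) (nsq_nonneg (y ∘ Sum.inr)))
    have h6 := mul_le_mul_of_nonneg_right (neg_abs_le z.im) (nsq_nonneg (y ∘ Sum.inl))
    have h7 := mul_le_mul_of_nonneg_right (le_abs_self z.im) (nsq_nonneg (y ∘ Sum.inr))
    linarith

/-- Solutions in the nonnegative cone decay like `exp ((N - Im z) x)`. -/
lemma nsq_mulVec_le_exp_of_nonneg (hY : IsFundamental (fun s => auxG z (v s)) Y) (hX : 0 ≤ X)
    (hN : ∀ s ∈ Icc 0 X, opNorm (v s) ≤ N) {g : Fin m₁ ⊕ Fin m₂ → ℂ}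
    (hg : ∀ s ≥ 0, 0 ≤ indef (Y s *ᵥ g)) :
    nsq (Y X *ᵥ g) ≤ 2 * Real.exp (2 * (-z.im + N) * X) * nsq (g ∘ Sum.inl) := by
  have h := le_exp_mul_of_deriv_le (f := fun s => nsq ((Y s *ᵥ g) ∘ Sum.inl))
    (k := 2 * (-z.im + N)) hX
    (fun s hs => hasDerivWithinAt_nsq (hasDerivWithinAt_comp_inl hY g hs.1)) fun s hs => ?_
  · simp only [hY.1, one_mulVec] at h
    have := hg X hX
    rw [indef] at this
    rw [nsq_sum]
    linarith
  · set y := Y s *ᵥ g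
    -- In the cone the first component controls the second, so the coupling costs only `N`.
    have h0 : nsq (y ∘ Sum.inr) ≤ nsq (y ∘ Sum.inl) := by
      have := hg s hs.1
      rw [indef] at this
      linarith
    have h1 := re_inl_le z (v s) y
    have h3 := sqrt_mul_sqrt_le _ _ (nsq_nonneg (y ∘ Sum.inl)) (nsq_nonneg (y ∘ Sum.inr))
    have h4 := mul_le_mul_of_nonneg_left (h3.trans (add_le_add_right h0 _)) (opNorm_nonneg (v s))
    have h5 := mul_le_mul_of_nonneg_right (hN s hs) (nsq_nonneg (y ∘ Sum.inl))
    linarith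

/-- Solutions in the nonpositive cone grow at most like `exp ((N + Im z) x)`. -/
lemma nsq_mulVec_le_exp_of_nonpos (hY : IsFundamental (fun s => auxG z (v s)) Y) (hX : 0 ≤ X)
    (hN : ∀ s ∈ Icc 0 X, opNorm (v s) ≤ N) {g : Fin m₁ ⊕ Fin m₂ → ℂ}
    (hg : ∀ s ≥ 0, indef (Y s *ᵥ g) ≤ 0) :
    nsq (Y X *ᵥ g) ≤ 2 * Real.exp (2 * (z.im + N) * X) * nsq (g ∘ Sum.inr) := by
  have h := le_exp_mul_of_deriv_le (f := fun s => nsq ((Y s *ᵥ g) ∘ Sum.inr))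
    (k := 2 * (z.im + N)) hX
    (fun s hs => hasDerivWithinAt_nsq (hasDerivWithinAt_comp_inr hY g hs.1)) fun s hs => ?_
  · simp only [hY.1, one_mulVec] at h
    have := hg X hX
    rw [indef] at this
    rw [nsq_sum]
    linarith
  · set y := Y s *ᵥ g
    have h0 : nsq (y ∘ Sum.inl) ≤ nsq (y ∘ Sum.inr) := by
      have := hg s hs.1
      rw [indef] at this
      linarith
    have h1 := re_inr_le z (v s) y
    have h3 := sqrt_mul_sqrt_le _ _ (nsq_nonneg (y ∘ Sum.inl)) (nsq_nonneg (y ∘ Sum.inr))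
    have h4 := mul_le_mul_of_nonneg_left (h3.trans (add_le_add_left h0 _)) (opNorm_nonneg (v s))
    have h5 := mul_le_mul_of_nonneg_right (hN s hs) (nsq_nonneg (y ∘ Sum.inr))
    linarith

/-- The infinitesimal form of the conservation law `u(x, z̄)* j u(x, z) = j`; it follows by taking
the adjoint of `j G = i (z + V)`. -/
lemma auxG_conj_conjTranspose_mul (z : ℂ) (v : Matrix (Fin m₁) (Fin m₂) ℂ) :
    (auxG (star z) v)ᴴ * jMat m₁ m₂ = -(jMat m₁ m₂ * auxG z v) := by
  have h := congrArg conjTranspose (jMat_mul_auxG (star z) v)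
  rw [conjTranspose_mul, jMat_conjTranspose] at h
  rw [h, jMat_mul_auxG, conjTranspose_smul, conjTranspose_add, conjTranspose_smul,
    potential_conjTranspose]
  simp [add_comm]

lemma hasDerivWithinAt_conjTranspose {m n : Type*} [Fintype m] [Fintype n]
    {f : ℝ → Matrix m n ℂ} {f' : Matrix m n ℂ} {S : Set ℝ} {s : ℝ}
    (hf : HasDerivWithinAt f f' S s) : HasDerivWithinAt (fun r => (f r)ᴴ) f'ᴴ S s :=
  hasDerivWithinAt_matrix.2 fun i k => (hasDerivWithinAt_matrix.1 hf k i).star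

open scoped Matrix.Norms.L2Operator in
lemma hasDerivWithinAt_matrix_mul {f g : ℝ → BlockMat m₁ m₂} {f' g' : BlockMat m₁ m₂}
    {S : Set ℝ} {s : ℝ} (hf : HasDerivWithinAt f f' S s) (hg : HasDerivWithinAt g g' S s) :
    HasDerivWithinAt (fun r => f r * g r) (f' * g s + f s * g') S s := hf.mul hg

open scoped Matrix.Norms.L2Operator in
lemma eq_of_hasDerivWithinAt_zero {f : ℝ → BlockMat m₁ m₂}
    (hf : ∀ s ≥ 0, HasDerivWithinAt f 0 (Ici 0) s) {s : ℝ} (hs : 0 ≤ s) : f s = f 0 :=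
  fundamental_unique (A := 0) (Y := f) (Z := fun _ => f 0) continuousOn_const
    (fun s hs => by simpa using hf s hs)
    (fun s _ => by simpa using hasDerivWithinAt_const s _ (f 0)) rfl s hs

open scoped Matrix.Norms.L2Operator in
/-- Conservation of the indefinite pairing between the systems at `z` and at its conjugate. -/
lemma conjTranspose_mul_jMat_mul {Z : ℝ → BlockMat m₁ m₂}
    (hY : IsFundamental (fun s => auxG z (v s)) Y)
    (hZ : IsFundamental (fun s => auxG (star z) (v s)) Z) {s : ℝ} (hs : 0 ≤ s) :
    (Z s)ᴴ * (jMat m₁ m₂ * Y s) = jMat m₁ m₂ := by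
  have h := eq_of_hasDerivWithinAt_zero (f := fun s => (Z s)ᴴ * (jMat m₁ m₂ * Y s))
    (fun s hs => ?_) hs
  · simpa [hY.1, hZ.1] using h
  · have hj := hasDerivWithinAt_matrix_mul (hasDerivWithinAt_const s (Ici (0 : ℝ)) (jMat m₁ m₂))
      (hY.2 s hs)
    refine (hasDerivWithinAt_matrix_mul (hasDerivWithinAt_conjTranspose (hZ.2 s hs))
      hj).congr_deriv ?_
    have := auxG_conj_conjTranspose_mul z (v s)
    rw [conjTranspose_mul, mul_assoc, ← mul_assoc _ (jMat m₁ m₂), this, zero_mul, zero_add,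
      ← mul_assoc (jMat m₁ m₂), neg_mul, mul_neg, neg_add_cancel]

lemma star_dotProduct_jMat {Z : ℝ → BlockMat m₁ m₂}
    (hY : IsFundamental (fun s => auxG z (v s)) Y)
    (hZ : IsFundamental (fun s => auxG (star z) (v s)) Z) {s : ℝ} (hs : 0 ≤ s)
    (a b : Fin m₁ ⊕ Fin m₂ → ℂ) :
    star (Z s *ᵥ a) ⬝ᵥ (jMat m₁ m₂ *ᵥ (Y s *ᵥ b)) = star a ⬝ᵥ (jMat m₁ m₂ *ᵥ b) := by
  rw [star_mulVec, ← dotProduct_mulVec, mulVec_mulVec, mulVec_mulVec, Matrix.mul_assoc,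
    conjTranspose_mul_jMat_mul hY hZ hs]

/-- The conservation law exhibits the inverse: `j u(x, z̄)* j`. -/
lemma isUnit_of_isFundamental_auxG (hv : ContinuousOn v (Ici 0))
    (hY : IsFundamental (fun s => auxG z (v s)) Y) {s : ℝ} (hs : 0 ≤ s) : IsUnit (Y s) := by
  obtain ⟨Z, hZ⟩ := exists_isFundamental (A := fun s => auxG (star z) (v s))
    ((continuous_auxG (star z)).comp_continuousOn hv)
  refine IsUnit.of_mul_eq_one_right (jMat m₁ m₂ * (Z s)ᴴ * jMat m₁ m₂) ?_
  rw [mul_assoc, mul_assoc, conjTranspose_mul_jMat_mul hY hZ hs, jMat_mul_jMat]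

lemma nsq_jMat_mulVec (y : Fin m₁ ⊕ Fin m₂ → ℂ) : nsq (jMat m₁ m₂ *ᵥ y) = nsq y := by
  rw [nsq_sum, jMat_mulVec_inl, jMat_mulVec_inr, nsq_neg, ← nsq_sum]

lemma star_elim_dotProduct_jMat (a c : Fin m₁ → ℂ) (b d : Fin m₂ → ℂ) :
    star (Sum.elim a b) ⬝ᵥ (jMat m₁ m₂ *ᵥ Sum.elim c d) = star a ⬝ᵥ c - star b ⬝ᵥ d := by
  rw [star_dotProduct_sum, jMat_mulVec_inl, jMat_mulVec_inr]
  simp [sub_eq_add_neg]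

/-- The solutions at the conjugate point dual to Weyl solutions lie in the nonpositive cone. -/
lemma indef_dual_nonpos {Z : ℝ → BlockMat m₁ m₂} (hv : ContinuousOn v (Ici 0))
    (hY : IsFundamental (fun s => auxG z (v s)) Y)
    (hZ : IsFundamental (fun s => auxG (star z) (v s)) Z) {φ : Matrix (Fin m₂) (Fin m₁) ℂ}
    {s : ℝ} (hs : 0 ≤ s) (hφ : ∀ x, 0 ≤ indef (Y s *ᵥ Sum.elim x (φ *ᵥ x))) (c : Fin m₂ → ℂ) :
    indef (Z s *ᵥ Sum.elim (φᴴ *ᵥ c) c) ≤ 0 := by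
  set y := Z s *ᵥ Sum.elim (φᴴ *ᵥ c) c
  -- The first components of Weyl solutions fill the whole space: if one vanishes, nonnegativity of
  -- the form kills the second component too, and the solution is zero.
  have hsurj : ∃ a, (Y s *ᵥ Sum.elim a (φ *ᵥ a)) ∘ Sum.inl = y ∘ Sum.inl := by
    set Ψ := (Y s).toBlocks₁₁ + (Y s).toBlocks₁₂ * φ
    have hΨ (a) : (Y s *ᵥ Sum.elim a (φ *ᵥ a)) ∘ Sum.inl = Ψ *ᵥ a := by
      rw [mulVec_elim_inl, add_mulVec, mulVec_mulVec]
    simp only [hΨ]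
    refine mulVec_surjective_iff_isUnit.2 (mulVec_injective_iff_isUnit.1 ?_) (y ∘ Sum.inl)
    rw [← coe_mulVecLin, injective_iff_map_eq_zero]
    intro a ha
    rw [mulVecLin_apply, ← hΨ] at ha
    have h := hφ a
    rw [indef, ha, nsq_zero, zero_sub, Left.nonneg_neg_iff] at h
    have h0 : Y s *ᵥ Sum.elim a (φ *ᵥ a) = 0 := nsq_eq_zero (by rw [nsq_sum, ha, nsq_zero]; linarith)
    have h1 : Sum.elim a (φ *ᵥ a) = 0 :=
      mulVec_injective_iff_isUnit.2 (isUnit_of_isFundamental_auxG hv hY hs)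
        (h0.trans (mulVec_zero _).symm)
    ext i
    exact congrFun h1 (Sum.inl i)
  obtain ⟨a, ha⟩ := hsurj
  set p := Y s *ᵥ Sum.elim a (φ *ᵥ a)
  -- The starting vectors are `j`-orthogonal. As `p₁ = y₁`, this gives `|y₁|² = y₂* p₂` up to
  -- conjugation, while `|p₂| ≤ |p₁| = |y₁|`; hence `|y₁| ≤ |y₂|`.
  have hpair : star y ⬝ᵥ (jMat m₁ m₂ *ᵥ p) = 0 := by
    rw [star_dotProduct_jMat hY hZ hs, star_elim_dotProduct_jMat, star_mulVec, ← dotProduct_mulVec,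
      conjTranspose_conjTranspose, sub_self]
  rw [star_dotProduct_sum, jMat_mulVec_inl, jMat_mulVec_inr, ha, star_dotProduct_self,
    dotProduct_neg, ← sub_eq_add_neg, sub_eq_zero] at hpair
  have h1 := norm_star_dotProduct_le_half (y ∘ Sum.inr) (p ∘ Sum.inr)
  rw [← hpair, Complex.norm_real, Real.norm_of_nonneg (nsq_nonneg _)] at h1
  have h2 := hφ a
  rw [indef, ha] at h2
  rw [indef]
  linarith

end BorgMarchenko

/-! ### The Borg–Marchenko theorem. -/

section BorgMarchenkoUniqueness

open Matrix

variable {m₁ m₂ : ℕ} {v w : ℝ → Matrix (Fin m₁) (Fin m₂) ℂ} {z : ℂ} {N X B : ℝ}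

lemma norm_star_dotProduct_sq_le {ι : Type*} [Fintype ι] (x y : ι → ℂ) :
    ‖star x ⬝ᵥ y‖ ^ 2 ≤ nsq x * nsq y := by
  have h := pow_le_pow_left₀ (norm_nonneg _) (norm_star_dotProduct_le x y) 2
  rwa [mul_pow, Real.sq_sqrt (nsq_nonneg x), Real.sq_sqrt (nsq_nonneg y)] at h

lemma nsq_add_le {ι : Type*} [Fintype ι] (x y : ι → ℂ) :
    nsq (x + y) ≤ 2 * nsq x + 2 * nsq y := by
  have h := parallelogram_law_with_norm ℂ (WithLp.toLp 2 x) (WithLp.toLp 2 y)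
  simp only [nsq_eq_norm_sq, WithLp.toLp_add]
  nlinarith [sq_nonneg ‖WithLp.toLp 2 x - WithLp.toLp 2 y‖]

lemma le_mul_of_sq_le {a b K : ℝ} (ha : 0 ≤ a) (hb : 0 ≤ b) (hK : 0 ≤ K)
    (h : a ^ 2 ≤ K * a * b) : a ≤ K * b := by
  rcases ha.eq_or_lt with h0 | h0
  · rw [← h0]; exact mul_nonneg hK hb
  · refine le_of_mul_le_mul_right ?_ h0
    linarith

/-- Lower bound for the growth of solutions. -/
lemma nsq_le_exp_mul {Y : ℝ → BlockMat m₁ m₂} (hv : ContinuousOn v (Ici 0))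
    (hY : IsFundamental (fun s => auxG z (v s)) Y) (hX : 0 ≤ X)
    (hN : ∀ s ∈ Icc 0 X, opNorm (v s) ≤ N) (c : Fin m₁ ⊕ Fin m₂ → ℂ) :
    nsq c ≤ Real.exp (2 * (|z.im| + N) * X) * nsq (Y X *ᵥ c) := by
  obtain ⟨Z, hZ⟩ := exists_isFundamental (A := fun s => auxG (star z) (v s))
    ((continuous_auxG (star z)).comp_continuousOn hv)
  -- Pairing with the conjugate solution started at `j c` recovers `|c|²` by conservation; the upper
  -- growth bound for that solution becomes a lower bound for `Y`.
  have h1 := norm_star_dotProduct_sq_le (Z X *ᵥ (jMat m₁ m₂ *ᵥ c))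
    (jMat m₁ m₂ *ᵥ (Y X *ᵥ c))
  have h2 := nsq_mulVec_le_exp hZ hX hN (jMat m₁ m₂ *ᵥ c)
  have e : star (jMat m₁ m₂ *ᵥ c) ⬝ᵥ (jMat m₁ m₂ *ᵥ c) = (nsq c : ℂ) := by
    rw [star_dotProduct_self, nsq_jMat_mulVec]
  rw [star_dotProduct_jMat hY hZ hX, e, Complex.norm_real,
    Real.norm_of_nonneg (nsq_nonneg c), nsq_jMat_mulVec] at h1
  rw [nsq_jMat_mulVec, show |(star z).im| = |z.im| by simp] at h2
  exact le_mul_of_sq_le (nsq_nonneg _) (nsq_nonneg _) (Real.exp_pos _).le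
    (h1.trans (mul_le_mul_of_nonneg_right h2 (nsq_nonneg _)))

/-- Comparison of two systems with the same Weyl solution at `z` in the upper half-plane. -/
lemma nsq_mulVec_le_of_common_weyl {Y W : ℝ → BlockMat m₁ m₂} (hz : 0 < z.im)
    (hw : ContinuousOn w (Ici 0))
    (hY : IsFundamental (fun s => auxG z (v s)) Y) (hW : IsFundamental (fun s => auxG z (w s)) W)
    (hX : 0 ≤ X) (hNv : ∀ s ∈ Icc 0 X, opNorm (v s) ≤ N) (hNw : ∀ s ∈ Icc 0 X, opNorm (w s) ≤ N)
    {φ : Matrix (Fin m₂) (Fin m₁) ℂ}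
    (hφv : ∀ s ≥ 0, ∀ x, 0 ≤ indef (Y s *ᵥ Sum.elim x (φ *ᵥ x)))
    (hφw : ∀ s ≥ 0, ∀ x, 0 ≤ indef (W s *ᵥ Sum.elim x (φ *ᵥ x)))
    (c : Fin m₁ ⊕ Fin m₂ → ℂ) :
    nsq (Y X *ᵥ c) ≤ 8 * Real.exp (4 * N * X) * nsq (W X *ᵥ c) := by
  obtain ⟨Z, hZ⟩ := exists_isFundamental (A := fun s => auxG (star z) (w s))
    ((continuous_auxG (star z)).comp_continuousOn hw)
  set g := W X *ᵥ c
  set c₁ := c ∘ Sum.inl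
  -- The data split into a Weyl part, which decays in `v`'s system, and a remainder `(0, d)`, which
  -- may grow. Their sizes, measured through `w`'s system, are bounded by `E` and `2 E'`, so in each
  -- product the dependence on `Im z` cancels: `E E' = exp (4 N X)`.
  set d := c ∘ Sum.inr - φ *ᵥ c₁
  have hc : c = Sum.elim c₁ (φ *ᵥ c₁) + Sum.elim (0 : Fin m₁ → ℂ) d := by
    ext (i | i) <;> simp [c₁, d]
  set E := Real.exp (2 * (z.im + N) * X)
  set E' := Real.exp (2 * (-z.im + N) * X)
  have hE : 0 < E := Real.exp_pos _
  have hE' : 0 < E' := Real.exp_pos _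
  have hEE : E * E' = Real.exp (4 * N * X) := by
    simp only [E, E', ← Real.exp_add]
    congr 1; ring
  have habs : |z.im| = z.im := abs_of_pos hz
  have hg := nsq_nonneg g
  have hc₁ : nsq c₁ ≤ E * nsq g := by
    have h := nsq_le_exp_mul hw hW hX hNw c
    rw [habs] at h
    refine le_trans ?_ h
    rw [nsq_sum c]
    linarith [nsq_nonneg (c ∘ Sum.inr)]
  have hd : nsq d ≤ 2 * E' * nsq g := by
    -- Pairing with the dual solution annihilates the Weyl part and leaves `-|d|²`; at the conjugate
    -- point its growth rate is only `N - Im z`.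
    have h1 := norm_star_dotProduct_sq_le (Z X *ᵥ Sum.elim (φᴴ *ᵥ d) d) (jMat m₁ m₂ *ᵥ g)
    have h2 := nsq_mulVec_le_exp_of_nonpos hZ hX hNw (g := Sum.elim (φᴴ *ᵥ d) d)
      fun s hs => indef_dual_nonpos hw hW hZ hs (hφw s hs) d
    have e : star (Sum.elim (φᴴ *ᵥ d) d) ⬝ᵥ (jMat m₁ m₂ *ᵥ c) = -(nsq d : ℂ) := by
      conv_lhs => rw [hc]
      rw [mulVec_add, dotProduct_add, star_elim_dotProduct_jMat, star_elim_dotProduct_jMat,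
        star_mulVec, ← dotProduct_mulVec, conjTranspose_conjTranspose, star_dotProduct_self]
      simp
    rw [star_dotProduct_jMat hW hZ hX, e, norm_neg, Complex.norm_real,
      Real.norm_of_nonneg (nsq_nonneg d), nsq_jMat_mulVec] at h1
    rw [Sum.elim_comp_inr, show (star z).im = -z.im by simp] at h2
    exact le_mul_of_sq_le (nsq_nonneg _) hg (by positivity)
      (h1.trans (mul_le_mul_of_nonneg_right h2 hg))
  have hw₁ := nsq_mulVec_le_exp_of_nonneg hY hX hNv (g := Sum.elim c₁ (φ *ᵥ c₁))
    fun s hs => hφv s hs c₁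
  rw [Sum.elim_comp_inl] at hw₁
  have hw₂ := nsq_mulVec_le_exp hY hX hNv (Sum.elim (0 : Fin m₁ → ℂ) d)
  rw [habs, nsq_sum (Sum.elim 0 d), Sum.elim_comp_inl, Sum.elim_comp_inr, nsq_zero, zero_add] at hw₂
  have h := nsq_add_le (Y X *ᵥ Sum.elim c₁ (φ *ᵥ c₁)) (Y X *ᵥ Sum.elim (0 : Fin m₁ → ℂ) d)
  rw [← mulVec_add, ← hc] at h
  have h1 := mul_le_mul_of_nonneg_left hc₁ (by positivity : 0 ≤ 2 * E')
  have h2 := mul_le_mul_of_nonneg_left hd hE.le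
  rw [← hEE]
  linarith

/-- Transfer of the comparison to the conjugate point. -/
lemma nsq_mulVec_le_of_dual {Y W Y' W' : ℝ → BlockMat m₁ m₂} (hv : ContinuousOn v (Ici 0))
    (hY : IsFundamental (fun s => auxG z (v s)) Y) (hW : IsFundamental (fun s => auxG z (w s)) W)
    (hY' : IsFundamental (fun s => auxG (star z) (v s)) Y')
    (hW' : IsFundamental (fun s => auxG (star z) (w s)) W') (hX : 0 ≤ X) (hB : 0 ≤ B)
    (h : ∀ c, nsq (W' X *ᵥ c) ≤ B * nsq (Y' X *ᵥ c)) (c : Fin m₁ ⊕ Fin m₂ → ℂ) :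
    nsq (Y X *ᵥ c) ≤ B * nsq (W X *ᵥ c) := by
  -- With `Y' a = j Y c` the conserved pairing equals `|Y c|²`, and conservation for `w` rewrites it
  -- as the pairing of `W' a` with `W c`.
  obtain ⟨a, ha⟩ := mulVec_surjective_iff_isUnit.2 (isUnit_of_isFundamental_auxG hv hY' hX)
    (jMat m₁ m₂ *ᵥ (Y X *ᵥ c))
  have h1 := star_dotProduct_jMat hY hY' hX a c
  rw [← star_dotProduct_jMat hW hW' hX a c, ha, star_dotProduct_self, nsq_jMat_mulVec] at h1
  have h2 := norm_star_dotProduct_sq_le (W' X *ᵥ a) (jMat m₁ m₂ *ᵥ (W X *ᵥ c))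
  have h3 := h a
  rw [ha, nsq_jMat_mulVec] at h3
  rw [← h1, Complex.norm_real, Real.norm_of_nonneg (nsq_nonneg _), nsq_jMat_mulVec] at h2
  exact le_mul_of_sq_le (nsq_nonneg _) (nsq_nonneg _) hB
    (h2.trans (mul_le_mul_of_nonneg_right h3 (nsq_nonneg _)))

/-- Comparison of two systems with the same Weyl solutions, for all `z`. -/
lemma nsq_mulVec_le_of_weyl {u u' : ℝ → ℂ → BlockMat m₁ m₂} {φ : ℂ → Matrix (Fin m₂) (Fin m₁) ℂ}
    (hv : ContinuousOn v (Ici 0)) (hw : ContinuousOn w (Ici 0))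
    (hu : ∀ z, IsFundamental (fun s => auxG z (v s)) fun s => u s z)
    (hu' : ∀ z, IsFundamental (fun s => auxG z (w s)) fun s => u' s z)
    (hX : 0 ≤ X)
    (hNv : ∀ s ∈ Icc 0 X, opNorm (v s) ≤ N) (hNw : ∀ s ∈ Icc 0 X, opNorm (w s) ≤ N)
    (hφv : ∀ z : ℂ, 0 < z.im → ∀ s ≥ 0, ∀ x, 0 ≤ indef (u s z *ᵥ Sum.elim x (φ z *ᵥ x)))
    (hφw : ∀ z : ℂ, 0 < z.im → ∀ s ≥ 0, ∀ x, 0 ≤ indef (u' s z *ᵥ Sum.elim x (φ z *ᵥ x)))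
    (z : ℂ) (c : Fin m₁ ⊕ Fin m₂ → ℂ) :
    nsq (u X z *ᵥ c) ≤ 8 * Real.exp (4 * N * X) * nsq (u' X z *ᵥ c) := by
  rcases lt_trichotomy z.im 0 with hz | hz | hz
  · have hz' : 0 < (star z).im := by simpa using hz
    have h := nsq_mulVec_le_of_common_weyl hz' hv (hu' (star z)) (hu (star z)) hX hNw hNv
      (hφw _ hz') (hφv _ hz')
    exact nsq_mulVec_le_of_dual hv (hu z) (hu' z) (hu (star z)) (hu' (star z)) hX
      (by positivity) h c
  -- On the real axis no Weyl solution is needed: the elementary growth bounds do not see `Re z`.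
  · have h1 := nsq_mulVec_le_exp (hu z) hX hNv c
    have h2 := nsq_le_exp_mul hw (hu' z) hX hNw c
    have h3 := h1.trans (mul_le_mul_of_nonneg_left h2 (Real.exp_pos _).le)
    rw [← mul_assoc, ← Real.exp_add, hz, abs_zero, zero_add,
      show 2 * N * X + 2 * N * X = 4 * N * X by ring] at h3
    have := mul_nonneg (Real.exp_pos (4 * N * X)).le (nsq_nonneg (u' X z *ᵥ c))
    linarith
  · exact nsq_mulVec_le_of_common_weyl hz hw (hu z) (hu' z) hX hNv hNw (hφv z hz) (hφw z hz) c

open scoped Matrix.Norms.L2Operator in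
lemma exists_opNorm_le (hv : ContinuousOn v (Ici 0)) (X : ℝ) :
    ∃ N, ∀ s ∈ Icc 0 X, opNorm (v s) ≤ N := by
  obtain ⟨K, -, hK⟩ := exists_norm_le_on_Icc hv X
  exact ⟨K, hK⟩

open scoped Matrix.Norms.L2Operator in
/-- If the fundamental solutions of two systems differ, for every `z`, by a left factor that does
not depend on `z`, then the systems coincide. -/
theorem potential_unique_of_factor {u u' : ℝ → ℂ → BlockMat m₁ m₂}
    (hw : ContinuousOn w (Ici 0)) (hu : IsFundamentalSolution (fun x z => auxG z (v x)) u)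
    (hu' : IsFundamentalSolution (fun x z => auxG z (w x)) u')
    (hT : ∀ s ≥ 0, ∃ T, ∀ z, u s z = T * u' s z) : ∀ s ≥ 0, v s = w s := by
  set j := jMat m₁ m₂
  choose! T hT using hT
  have hj1 : j * j = 1 := jMat_mul_jMat
  -- An explicit formula for the factor, from which its differentiability is read off.
  have hT' : ∀ s ≥ 0, T s = u s 0 * (j * (u' s 0)ᴴ * j) := fun s hs => by
    have h := conjTranspose_mul_jMat_mul (hu'.isFundamental 0)
      (Z := fun s => u' s 0) (by simpa using hu'.isFundamental 0) hs
    have hinv : u' s 0 * (j * (u' s 0)ᴴ * j) = 1 := by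
      rw [mul_eq_one_comm, mul_assoc, mul_assoc, h, hj1]
    rw [hT s hs 0, mul_assoc, hinv, mul_one]
  have hdiff : ∀ s ≥ 0, ∃ T', HasDerivWithinAt T T' (Ici 0) s := fun s hs => by
    have hd := hasDerivWithinAt_matrix_mul ((hu 0).2 s hs) (hasDerivWithinAt_matrix_mul
      (hasDerivWithinAt_matrix_mul (hasDerivWithinAt_const s (Ici (0 : ℝ)) j)
        (hasDerivWithinAt_conjTranspose ((hu' 0).2 s hs)))
      (hasDerivWithinAt_const s (Ici (0 : ℝ)) j))
    exact ⟨_, hd.congr_of_mem (fun r hr => hT' r hr) hs⟩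
  choose! T' hT'd using hdiff
  have hode : ∀ s ≥ 0, ∀ z, T' s + T s * auxG z (w s) = auxG z (v s) * T s := fun s hs z => by
    have h1 := hasDerivWithinAt_matrix_mul (hT'd s hs) ((hu' z).2 s hs)
    have h2 := ((hu z).2 s hs).congr_of_mem (fun r hr => (hT r hr z).symm) hs
    have h3 := ((uniqueDiffOn_Ici (0 : ℝ)) s hs).eq_deriv _ h1 h2
    have hunit := isUnit_of_isFundamental_auxG hw (hu'.isFundamental z) hs
    refine hunit.mul_right_cancel ?_
    rw [add_mul, mul_assoc, mul_assoc, ← hT s hs z]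
    exact h3
  have hG0 (q : Matrix (Fin m₁) (Fin m₂) ℂ) : auxG 0 q = Complex.I • (j * potential q) := by
    simp [auxG, j]
  have hG1 (q : Matrix (Fin m₁) (Fin m₂) ℂ) : auxG 1 q = Complex.I • j + auxG 0 q := by
    simp [auxG, j]
  -- Coefficient of `z` in the gauge relation, obtained by comparing `z = 0` and `z = 1`.
  have hcomm : ∀ s ≥ 0, T s * j = j * T s := fun s hs => by
    have h0 := hode s hs 0
    have h1 := hode s hs 1
    rw [hG1, hG1, mul_add, add_mul, mul_smul_comm, smul_mul_assoc] at h1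
    have h2 : Complex.I • (T s * j) = Complex.I • (j * T s) := by
      rw [← h0] at h1
      have : Complex.I • (T s * j) + (T' s + T s * auxG 0 (w s)) =
        Complex.I • (j * T s) + (T' s + T s * auxG 0 (w s)) := by rw [← h1]; abel
      exact add_right_cancel this
    exact smul_right_injective _ Complex.I_ne_zero h2
  have hcomm' : ∀ s ≥ 0, T' s * j = j * T' s := fun s hs => by
    have h1 := hasDerivWithinAt_matrix_mul (hT'd s hs) (hasDerivWithinAt_const s (Ici (0 : ℝ)) j)
    have h2 := (hasDerivWithinAt_matrix_mul (hasDerivWithinAt_const s (Ici (0 : ℝ)) j)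
      (hT'd s hs)).congr_of_mem (fun r hr => hcomm r hr) hs
    simpa using ((uniqueDiffOn_Ici (0 : ℝ)) s hs).eq_deriv _ h1 h2
  have hanti (q : Matrix (Fin m₁) (Fin m₂) ℂ) : auxG 0 q * j = -(j * auxG 0 q) := by
    have := jMat_mul_potential q
    rw [hG0, smul_mul_assoc, mul_smul_comm, ← smul_neg, mul_assoc, this, mul_neg, neg_neg]
  -- `T'` commutes with `j` because `T` does, yet at `z = 0` the gauge relation expresses it through
  -- off-diagonal matrices, so it also anticommutes with `j`.
  have hzero : ∀ s ≥ 0, T' s = 0 := fun s hs => by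
    have h0 : T' s = auxG 0 (v s) * T s - T s * auxG 0 (w s) := eq_sub_of_add_eq (hode s hs 0)
    have h1 : T' s * j = -(j * T' s) := by
      rw [h0, sub_mul, mul_assoc, hcomm s hs, ← mul_assoc, hanti, mul_assoc, hanti, mul_sub,
        ← mul_assoc j (T s), ← hcomm s hs]
      simp only [mul_assoc, neg_mul, mul_neg]
      abel
    rw [hcomm' s hs] at h1
    have h2 : j * T' s = 0 := by
      have : (2 : ℂ) • (j * T' s) = 0 := by
        rw [two_smul]
        nth_rewrite 1 [h1]
        exact neg_add_cancel _
      exact (smul_eq_zero.1 this).resolve_left two_ne_zero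
    rw [← one_mul (T' s), ← hj1, mul_assoc, h2, mul_zero]
  have hone : ∀ s ≥ 0, T s = 1 := fun s hs => by
    rw [eq_of_hasDerivWithinAt_zero (f := T) (fun s hs => hzero s hs ▸ hT'd s hs) hs]
    have := hT 0 le_rfl 0
    rwa [(hu 0).1, (hu' 0).1, mul_one, eq_comm] at this
  intro s hs
  have h := hode s hs 0
  rw [hzero s hs, hone s hs, zero_add, one_mul, mul_one, hG0, hG0] at h
  have h1 : j * potential (w s) = j * potential (v s) :=
    smul_right_injective _ Complex.I_ne_zero h
  have h2 := congrArg (fun M => (j * M).toBlocks₁₂) h1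
  simpa [← mul_assoc, hj1, potential] using h2.symm

open scoped Matrix.Norms.L2Operator in
lemma differentiable_mul_inv {M M' : ℂ → BlockMat m₁ m₂} (hM : Differentiable ℂ M)
    (hM' : Differentiable ℂ M') (hunit : ∀ z, IsUnit (M' z)) :
    Differentiable ℂ fun z => M z * (M' z)⁻¹ := by
  have h : Differentiable ℂ fun z => Ring.inverse (M' z) := fun z =>
    (differentiableAt_inverse (𝕜 := ℂ) (hunit z)).comp z (hM' z)
  simp only [nonsing_inv_eq_ringInverse]
  exact fun z => (hM z).mul (h z)

open scoped Matrix.Norms.L2Operator in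
/-- Borg–Marchenko uniqueness: the Weyl function determines the potential. -/
theorem potential_unique_of_weyl {φ ψ : ℂ → Matrix (Fin m₂) (Fin m₁) ℂ}
    (hv : ContinuousOn v (Ici 0)) (hw : ContinuousOn w (Ici 0))
    (hφ : IsWeylFunction v φ) (hψ : IsWeylFunction w ψ)
    (h : ∀ z : ℂ, 0 < z.im → φ z = ψ z) : ∀ s ≥ 0, v s = w s := by
  obtain ⟨u, hu⟩ := exists_isFundamentalSolution (A := fun x z => auxG z (v x)) fun z =>
    (continuous_auxG z).comp_continuousOn hv
  obtain ⟨u', hu'⟩ := exists_isFundamentalSolution (A := fun x z => auxG z (w x)) fun z =>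
    (continuous_auxG z).comp_continuousOn hw
  refine potential_unique_of_factor hw hu hu' fun X hX => ?_
  obtain ⟨N₁, hv₁⟩ := exists_opNorm_le hv X
  obtain ⟨N₂, hw₂⟩ := exists_opNorm_le hw X
  set N := max N₁ N₂
  have hNv : ∀ s ∈ Icc 0 X, opNorm (v s) ≤ N := fun s hs => (hv₁ s hs).trans (le_max_left _ _)
  have hNw : ∀ s ∈ Icc 0 X, opNorm (w s) ≤ N := fun s hs => (hw₂ s hs).trans (le_max_right _ _)
  have hfu : ∀ z, IsFundamental (fun s => auxG z (v s)) fun s => u s z := hu.isFundamental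
  have hfu' : ∀ z, IsFundamental (fun s => auxG z (w s)) fun s => u' s z := hu'.isFundamental
  set B := 8 * Real.exp (4 * N * X)
  have hbound : ∀ z c, nsq (u X z *ᵥ c) ≤ B * nsq (u' X z *ᵥ c) :=
    nsq_mulVec_le_of_weyl hv hw hfu hfu' hX hNv hNw
      (fun z hz s hs x => hφ.indef_nonneg hv hz (hfu z) hs x)
      (fun z hz s hs x => by rw [h z hz]; exact hψ.indef_nonneg hw hz (hfu' z) hs x)
  have hunit (z : ℂ) : IsUnit (u' X z) := isUnit_of_isFundamental_auxG hw (hfu' z) hX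
  have hdiff := differentiable_mul_inv (differentiable_apply_of_isFundamentalSolution hv hu hX)
    (differentiable_apply_of_isFundamentalSolution hw hu' hX) hunit
  -- Liouville's theorem, entrywise: the growth comparison, applied to `c = u'⁻¹ e_k`, bounds the
  -- entire quotient `u u'⁻¹`.
  have hent (i k) (z₁ z₂ : ℂ) :
      (u X z₁ * (u' X z₁)⁻¹) i k = (u X z₂ * (u' X z₂)⁻¹) i k := by
    refine Differentiable.apply_eq_apply_of_bounded
      (f := fun z => (u X z * (u' X z)⁻¹) i k)
      (fun z => differentiableAt_pi.1 (differentiableAt_pi.1 (hdiff z) i) k) ?_ z₁ z₂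
    refine isBounded_iff_forall_norm_le.2 ⟨√B, ?_⟩
    rintro _ ⟨z, rfl⟩
    refine Real.le_sqrt_of_sq_le ?_
    have h1 := norm_apply_sq_le_nsq ((u X z * (u' X z)⁻¹) *ᵥ Pi.single k 1) i
    have h2 := hbound z ((u' X z)⁻¹ *ᵥ Pi.single k 1)
    have e : nsq (Pi.single k 1 : Fin m₁ ⊕ Fin m₂ → ℂ) = 1 := by
      simp [nsq, Pi.single_apply, apply_ite norm]
    rw [mulVec_mulVec, mulVec_mulVec, mul_nonsing_inv _ ((isUnit_iff_isUnit_det _).1 (hunit z)),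
      one_mulVec, e, mul_one] at h2
    simpa using h1.trans h2
  refine ⟨u X 0 * (u' X 0)⁻¹, fun z => ?_⟩
  have : u X 0 * (u' X 0)⁻¹ = u X z * (u' X z)⁻¹ := Matrix.ext fun i k => hent i k 0 z
  rw [this, mul_assoc, nonsing_inv_mul _ ((isUnit_iff_isUnit_det _).1 (hunit z)), mul_one]

end BorgMarchenkoUniqueness

/-! ### Recovery of the Weyl function and of the solution from boundary data. -/

section Boundary

open Matrix

variable {m₁ m₂ : ℕ} {v w : ℝ → ℝ → Matrix (Fin m₁) (Fin m₂) ℂ}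

/-- Solutions may be shifted forward in time. -/
lemma IsSolution.shift (hv : IsSolution v) {t₀ : ℝ} (ht₀ : 0 ≤ t₀) :
    IsSolution fun x t => v x (t₀ + t) where
  contDiff i k := (hv.contDiff i k).comp (f := fun p : ℝ × ℝ => (p.1, t₀ + p.2))
    (by fun_prop) fun p hp => ⟨hp.1, add_nonneg ht₀ hp.2⟩
  exists_xx x hx t ht := hv.exists_xx x hx (t₀ + t) (add_nonneg ht₀ ht)
  equation x hx t ht := by
    have ht' : 0 ≤ t₀ + t := add_nonneg ht₀ ht
    have e : partialT (fun x t => v x (t₀ + t)) x t = partialT v x (t₀ + t) := by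
      ext i k
      have h := hasDerivWithinAt_matrix.1 (hv.hasDerivWithinAt_t hx ht') i k
      have h1 := HasDerivWithinAt.scomp t (h := fun s => t₀ + s) h
        ((hasDerivWithinAt_id t (Ici 0)).const_add t₀) fun s hs => add_nonneg ht₀ hs
      rw [one_smul] at h1
      exact h1.derivWithin (uniqueDiffOn_Ici 0 t ht)
    rw [e]
    exact hv.equation x hx (t₀ + t) ht'
  bounded t ht := by
    obtain ⟨M, hM, h⟩ := hv.bounded (t₀ + t) (add_nonneg ht₀ ht)
    exact ⟨M, hM, fun x hx s hs => h x hx _ ⟨add_nonneg ht₀ hs.1, by linarith [hs.2]⟩⟩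

/-- The Weyl function is recovered from the boundary values on `x = 0`. -/
theorem IsSolution.tendsto_discPoint (hv : IsSolution v) {M : ℝ} (hM : 0 < M)
    (hb : ∀ t ≥ 0, opNorm (v 0 t) ≤ M) {φ : ℂ → Matrix (Fin m₂) (Fin m₁) ℂ}
    (hφ : IsWeylFunction (fun x => v x 0) φ) {z : ℂ} (him : 1 / 2 ≤ z.im) (hre : z.re ≤ -M)
    {R : ℝ → BlockMat m₁ m₂} (hR : IsFundamental (fun t => auxF z (v 0 t) (partialX v 0 t)) R) :
    (∀ t ≥ 0, IsUnit (R t).toBlocks₂₂) ∧ Tendsto (fun t => discPoint (R t)) atTop (𝓝 (φ z)) := by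
  have hz : 0 < z.im := by linarith
  have hdis := isDissipative_auxF (vx := fun t => partialX v 0 t) hM.le hb him hre
  refine ⟨fun t ht => isUnit_toBlocks₂₂ hM.le hdis hR ht, DNLS.tendsto_discPoint hM hdis hR ?_⟩
  intro t ht x
  have hc := hv.continuousOn_slice (le_refl 0)
  obtain ⟨u, hu⟩ := exists_isFundamental (A := fun x => auxG z (v x 0))
    ((continuous_auxG z).comp_continuousOn hc)
  exact hv.indef_nonneg hz hu hR (fun s hs => hφ.indef_nonneg hc hz hu hs x) ht

/-- Weyl functions agreeing on a quadrant agree on the upper half-plane. -/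
lemma eq_of_eq_on_quadrant {φ ψ : ℂ → Matrix (Fin m₂) (Fin m₁) ℂ}
    (hφ : ∀ i k, DifferentiableOn ℂ (fun z => φ z i k) {z | 0 < z.im})
    (hψ : ∀ i k, DifferentiableOn ℂ (fun z => ψ z i k) {z | 0 < z.im}) {M : ℝ}
    (h : ∀ z : ℂ, 1 / 2 ≤ z.im → z.re ≤ -M → φ z = ψ z) {z : ℂ} (hz : 0 < z.im) : φ z = ψ z := by
  have hU : IsOpen {z : ℂ | 0 < z.im} := isOpen_lt continuous_const Complex.continuous_im
  ext i k
  refine ((hφ i k).analyticOnNhd hU).eqOn_of_preconnected_of_eventuallyEq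
    ((hψ i k).analyticOnNhd hU) (convex_halfSpace_im_gt 0).isPreconnected
    -- An interior point of the quadrant, so agreement holds in a neighbourhood and the identity
    -- theorem applies.
    (z₀ := ⟨-M - 1, 1⟩) (by simp) ?_ hz
  have h1 : {z : ℂ | 1 / 2 < z.im} ∈ 𝓝 (⟨-M - 1, 1⟩ : ℂ) :=
    (isOpen_lt continuous_const Complex.continuous_im).mem_nhds (by
      change (1 / 2 : ℝ) < 1; norm_num)
  have h2 : {z : ℂ | z.re < -M} ∈ 𝓝 (⟨-M - 1, 1⟩ : ℂ) :=
    (isOpen_lt Complex.continuous_re continuous_const).mem_nhds (by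
      change -M - 1 < -M; linarith)
  filter_upwards [h1, h2] with z hz1 hz2
  rw [h z (le_of_lt hz1) (le_of_lt hz2)]

lemma IsSolution.continuousOn_boundary_auxF (hv : IsSolution v) (z : ℂ) :
    ContinuousOn (fun t => auxF z (v 0 t) (partialX v 0 t)) (Ici 0) :=
  (hv.continuousOn_auxF z).comp (f := fun t : ℝ => ((0 : ℝ), t)) (by fun_prop)
    fun _ ht => ⟨self_mem_Ici, ht⟩

/-- Solutions with the same Cauchy data on `x = 0` have the same initial values. -/
theorem IsSolution.eq_initial (hv : IsSolution v) (hw : IsSolution w) {M : ℝ} (hM : 0 < M)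
    (hb : ∀ t ≥ 0, opNorm (v 0 t) ≤ M) (h₂ : ∀ t ≥ 0, w 0 t = v 0 t)
    (h₃ : ∀ t ≥ 0, partialX w 0 t = partialX v 0 t) : ∀ x ≥ 0, w x 0 = v x 0 := by
  have hcv := hv.continuousOn_slice (le_refl 0)
  have hcw := hw.continuousOn_slice (le_refl 0)
  obtain ⟨φ, hφ⟩ := exists_isWeylFunction hcv
  obtain ⟨ψ, hψ⟩ := exists_isWeylFunction hcw
  refine potential_unique_of_weyl hcw hcv hψ hφ fun z hz =>
    eq_of_eq_on_quadrant hψ.1 hφ.1 (M := M) (fun z him hre => ?_) hz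
  -- The same `R` serves both solutions, so both Weyl functions are the limit of the same
  -- expression.
  obtain ⟨R, hR⟩ := exists_isFundamental (hv.continuousOn_boundary_auxF z)
  have hR' : IsFundamental (fun t => auxF z (w 0 t) (partialX w 0 t)) R :=
    ⟨hR.1, fun t ht => by beta_reduce; rw [h₂ t ht, h₃ t ht]; exact hR.2 t ht⟩
  exact tendsto_nhds_unique
    (hw.tendsto_discPoint hM (fun t ht => by rw [h₂ t ht]; exact hb t ht) hψ him hre hR').2
    (hv.tendsto_discPoint hM hb hφ him hre hR).2

/-- A solution is determined by its Cauchy data on `x = 0`. -/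
theorem IsSolution.eq_of_boundary (hv : IsSolution v) (hw : IsSolution w) {M : ℝ} (hM : 0 < M)
    (hb : ∀ t ≥ 0, opNorm (v 0 t) ≤ M) (h₂ : ∀ t ≥ 0, w 0 t = v 0 t)
    (h₃ : ∀ t ≥ 0, partialX w 0 t = partialX v 0 t) : ∀ x ≥ 0, ∀ t ≥ 0, w x t = v x t := by
  intro x hx t ht
  -- The values at time `t` are the initial values of the shifted solutions, whose boundary data
  -- still agree and obey the same bound.
  have h := (hv.shift ht).eq_initial (hw.shift ht) hM
    (fun s hs => hb _ (add_nonneg ht hs)) (fun s hs => h₂ _ (add_nonneg ht hs))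
    (fun s hs => h₃ _ (add_nonneg ht hs)) x hx
  simpa using h

end Boundary

end DNLS

theorem mainTheorem4 {m₁ m₂ : ℕ}
    (v : ℝ → ℝ → Matrix (Fin m₁) (Fin m₂) ℂ) (hv : DNLS.IsSolution v)
    (h₂ h₃ : ℝ → Matrix (Fin m₁) (Fin m₂) ℂ)
    (hv₂ : ∀ t ≥ 0, v 0 t = h₂ t) (hv₃ : ∀ t ≥ 0, DNLS.partialX v 0 t = h₃ t)
    (hcont₂ : ContinuousOn h₂ (Ici 0)) (hcont₃ : ContinuousOn h₃ (Ici 0))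
    (Mhat : ℝ) (hMhat : 0 < Mhat)
    (hbd₂ : ∃ c < Mhat, ∀ t ≥ 0, DNLS.opNorm (h₂ t) ≤ c)
    (hbd₃ : ∃ c, ∀ t ≥ 0, DNLS.opNorm (h₃ t) ≤ c) :
    -- the initial Weyl function exists
    (∃ φ : ℂ → Matrix (Fin m₂) (Fin m₁) ℂ, DNLS.IsWeylFunction (fun x => v x 0) φ) ∧
    -- and it is given by the boundary data
    (∀ φ : ℂ → Matrix (Fin m₂) (Fin m₁) ℂ, DNLS.IsWeylFunction (fun x => v x 0) φ →
      ∀ R : ℝ → ℂ → DNLS.BlockMat m₁ m₂,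
        DNLS.IsFundamentalSolution (fun t z => DNLS.auxF z (h₂ t) (h₃ t)) R →
        ∀ z : ℂ, 1 / 2 ≤ z.im → z.re ≤ -Mhat →
          (∀ t ≥ 0, IsUnit (R t z).toBlocks₂₂.det) ∧
          Tendsto (fun t => -((R t z).toBlocks₂₂⁻¹ * (R t z).toBlocks₂₁)) atTop (𝓝 (φ z))) ∧
    -- the solution is determined by the boundary data alone
    (∀ w : ℝ → ℝ → Matrix (Fin m₁) (Fin m₂) ℂ, DNLS.IsSolution w →
      (∀ t ≥ 0, w 0 t = h₂ t) → (∀ t ≥ 0, DNLS.partialX w 0 t = h₃ t) →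
      ∀ x ≥ 0, ∀ t ≥ 0, w x t = v x t) := by
  obtain ⟨c, hc, hbc⟩ := hbd₂
  have hb : ∀ t ≥ 0, DNLS.opNorm (v 0 t) ≤ Mhat := fun t ht => by
    rw [hv₂ t ht]; exact (hbc t ht).trans hc.le
  refine ⟨DNLS.exists_isWeylFunction (hv.continuousOn_slice le_rfl),
    fun φ hφ R hR z him hre => ?_, fun w hw hw₂ hw₃ => ?_⟩
  · have hR' : DNLS.IsFundamental (fun t => DNLS.auxF z (v 0 t) (DNLS.partialX v 0 t))
        fun t => R t z :=
      ⟨(hR z).1, fun t ht => by beta_reduce; rw [hv₂ t ht, hv₃ t ht]; exact (hR z).2 t ht⟩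
    obtain ⟨h₁, h₂⟩ := hv.tendsto_discPoint hMhat hb hφ him hre hR'
    exact ⟨fun t ht => (Matrix.isUnit_iff_isUnit_det _).1 (h₁ t ht), h₂⟩
  · exact hv.eq_of_boundary hw hMhat hb (fun t ht => (hw₂ t ht).trans (hv₂ t ht).symm)
      fun t ht => (hw₃ t ht).trans (hv₃ t ht).symm
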